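/- For a real matrix $A$ let $\|A\|_F$ be its Frobenius norm, $\|A\|_{\rm op}$ its (Euclidean) operator norm, and $\mathrm{st}(A):=\|A\|_F^2/\|A\|_{\rm op}^2$ its stable rank. For $\sigma\colon\mathbb{R}\to\mathbb{R}$ let $\sigma(A)$ denote the matrix obtained by applying $\sigma$ entrywise, and let $\hat\sigma_1(s):=\mathbb{E}[\sigma(s\gamma)\gamma]$ with $\gamma\sim\mathcal N(0,1)$ be the first Hermite coefficient of $\gamma\mapsto\sigma(s\gamma)$. **Theorem (Nonlinear activation).** There exists a numerical constant $c>0$ such that the following holds. Let $W\in\mathbb{R}^{k\times d}$ be a random matrix with i.i.d. entries $\mathcal N(0,\tfrac1d)$, and let $X\in\mathbb{R}^{d\times n}$, $n\ge 1$, be a fixed matrix with nonzero columns $x_1,\dots,x_n\in\mathbb{R}^d$. Let $\sigma\colon\mathbb{R}\to\mathbb{R}$ be a $1$-Lipschitz function with $|\sigma(t)|\le|t|$ for all $t\in\mathbb{R}$, and suppose that $$p:=\min_{i=1,\dots,n}\ \frac{d}{\|x_i\|_2^2}\cdot\hat\sigma_1\!\left(\frac{\|x_i\|_2}{\sqrt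 d}\right)^{2}>0 .$$ Then for every $\varepsilon\in(0,1)$, with probability at least $1-8\exp(-c\,\varepsilon^2p^2k)$ the following inequalities hold simultaneously: $$(1-\varepsilon)\frac pd\|X\|_F^2\ \le\ \frac1k\|\sigma(WX)\|_F^2\ \le\ (1+\varepsilon)\frac1d\|X\|_F^2,\qquad (1-\varepsilon)\frac pd\|X\|_{\rm op}^2\ \le\ \frac1k\|\sigma(WX)\|_{\rm op}^2 .$$ Consequently, whenever these inequalities hold, $$\mathrm{st}(\sigma(WX))\ \le\ \frac{1+\varepsilon}{1-\varepsilon}\cdot\frac1p\cdot\mathrm{st}(X).$$ -/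

import Mathlib

open MeasureTheory ProbabilityTheory
open scoped NNReal

noncomputable section

namespace StableRank

open scoped Matrix.Norms.Frobenius in
/-- The Frobenius norm of a real matrix. -/
def frobNorm {m n : ℕ} (A : Matrix (Fin m) (Fin n) ℝ) : ℝ := ‖A‖

open scoped Matrix.Norms.L2Operator in
/-- The operator norm of a real matrix with respect to the Euclidean norms. -/
def opNorm {m n : ℕ} (A : Matrix (Fin m) (Fin n) ℝ) : ℝ := ‖A‖

/-- The stable rank `‖A‖_F² / ‖A‖_op²`. -/
def stableRank {m n : ℕ} (A : Matrix (Fin m) (Fin n) ℝ) : ℝ :=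
  frobNorm A ^ 2 / opNorm A ^ 2

/-- The Euclidean norm of the `j`-th column of `X`. -/
def colNorm {d n : ℕ} (X : Matrix (Fin d) (Fin n) ℝ) (j : Fin n) : ℝ :=
  ‖WithLp.toLp 2 (X.col j)‖

/-- The `m`-th Hermite polynomial, normalized to be orthonormal in `L²` of the standard Gaussian
(`Polynomial.hermite m` is the monic probabilists' polynomial, with squared norm `m!`). -/
def orthoHermite (m : ℕ) (t : ℝ) : ℝ :=
  Polynomial.aeval t (Polynomial.hermite m) / √(m.factorial : ℝ)

/-- The Hermite coefficient `E[σ(sγ) h_m(γ)]`, where `γ` is standard normal. -/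
def hermiteCoeff (σ : ℝ → ℝ) (m : ℕ) (s : ℝ) : ℝ :=
  ∫ γ, σ (s * γ) * orthoHermite m γ ∂(gaussianReal 0 1)

/-- The quantity `(d / ‖x_j‖²) · σ̂₁(‖x_j‖ / √d)²` attached to the `j`-th column of `X`. -/
def columnParam {d n : ℕ} (σ : ℝ → ℝ) (X : Matrix (Fin d) (Fin n) ℝ) (j : Fin n) : ℝ :=
  (d : ℝ) / colNorm X j ^ 2 * hermiteCoeff σ 1 (colNorm X j / √(d : ℝ)) ^ 2

/-- `W` is a random `k × d` matrix with i.i.d. entries of law `N(0, 1/d)`. -/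
structure IsGaussianMatrix {Ω : Type*} [MeasurableSpace Ω] (P : Measure Ω) {k d : ℕ}
    (W : Ω → Matrix (Fin k) (Fin d) ℝ) : Prop where
  law : ∀ i j, HasLaw (fun ω => W ω i j) (gaussianReal 0 ((d : ℝ≥0)⁻¹)) P
  indep : iIndepFun (fun (ij : Fin k × Fin d) ω => W ω ij.1 ij.2) P

/-- The two-sided bound on `‖σ(WX)‖_F²` and the lower bound on `‖σ(WX)‖_op²`. -/
def NormBounds {k d n : ℕ} (σ : ℝ → ℝ) (p ε : ℝ)
    (W : Matrix (Fin k) (Fin d) ℝ) (X : Matrix (Fin d) (Fin n) ℝ) : Prop :=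
  (1 - ε) * (p / d) * frobNorm X ^ 2 ≤ 1 / k * frobNorm ((W * X).map σ) ^ 2 ∧
  1 / k * frobNorm ((W * X).map σ) ^ 2 ≤ (1 + ε) * (1 / d) * frobNorm X ^ 2 ∧
  (1 - ε) * (p / d) * opNorm X ^ 2 ≤ 1 / k * opNorm ((W * X).map σ) ^ 2

end StableRank

end

/-!
After moving the factor `1/√d` from `W` to the columns `a j` of `X`, the rows `w` of `W` are
independent standard Gaussian vectors, and the squared norms of `σ(WX)` are controlled by sums of
independent copies of `∑ j, σ ⟪a j, w⟫ ^ 2` (Frobenius) and of `(∑ j, u j * σ ⟪a j, w⟫) ^ 2` for a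
single well-chosen `u` (operator norm).

Regressing `σ ⟪a j, w⟫` on the Gaussian `⟪a j, w⟫` brings in its first Hermite coefficient `h j`.
Take a top right singular vector `y` of `X / √d` and rescale its entries to
`u j = y j * √p * ‖a j‖ / h j`; by the definition of `p` this does not increase the norm. The
correlation of `∑ j, u j * σ ⟪a j, w⟫` with `∑ j, y j * ⟪a j, w⟫` is then `√p * ‖X‖_op² / d`, and
Cauchy–Schwarz gives a second moment of at least `p * ‖X‖_op² / d`.

The summands are nonnegative, so their lower tail only needs a second moment bound, from
`exp (-x) ≤ 1 - x + x² / 2`. For the operator norm this means a fourth moment of a Lipschitz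
function of a Gaussian vector, bounded by the Maurey–Pisier rotation argument; for the Frobenius
norm, and for its upper tail, Jensen's inequality with weights `‖a j‖² / ∑ j, ‖a j‖²` reduces the
moments to those of a single squared Gaussian.
-/

namespace StableRank

open scoped Real Topology RealInnerProductSpace

section Chernoff

variable {Ω ι : Type*} [MeasurableSpace Ω] [Fintype ι] {P : Measure Ω} {Y : ι → Ω → ℝ}

lemma measureReal_le_sum_le_exp [IsProbabilityMeasure P] (hY : iIndepFun Y P)
    (hmeas : ∀ i, AEMeasurable (Y i) P) {t A : ℝ} (ht : 0 ≤ t)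
    (hint : ∀ i, Integrable (fun ω => Real.exp (t * Y i ω)) P)
    (hmgf : ∀ i, mgf (Y i) P t ≤ Real.exp A) (a : ℝ) :
    P.real {ω | Fintype.card ι * a ≤ ∑ i, Y i ω} ≤ Real.exp (Fintype.card ι * (A - t * a)) := by
  have mgf_sum : mgf (∑ i, Y i) P t = ∏ i, mgf (Y i) P t := hY.mgf_sum₀ hmeas Finset.univ
  have integrable_exp_sum : Integrable (fun ω => Real.exp (t * (∑ i, Y i) ω)) P := by
    rw [← mgf_pos_iff, mgf_sum]
    exact Finset.prod_pos fun i _ => mgf_pos (hint i)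
  calc P.real {ω | Fintype.card ι * a ≤ ∑ i, Y i ω}
      ≤ Real.exp (-t * (Fintype.card ι * a)) * mgf (∑ i, Y i) P t := by
        simpa only [Finset.sum_apply] using
          measure_ge_le_exp_mul_mgf (X := ∑ i, Y i) _ ht integrable_exp_sum
    _ ≤ Real.exp (-t * (Fintype.card ι * a)) * ∏ _i : ι, Real.exp A := by
        rw [mgf_sum]
        gcongr with i
        · exact fun i _ => mgf_nonneg
        · exact hmgf i
    _ = Real.exp (Fintype.card ι * (A - t * a)) := by
        rw [Finset.prod_const, Finset.card_univ, ← Real.exp_nat_mul, ← Real.exp_add]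
        ring_nf

lemma exp_neg_le_one_sub_add_sq_div_two {x : ℝ} (hx : 0 ≤ x) :
    Real.exp (-x) ≤ 1 - x + x ^ 2 / 2 := by
  rw [Real.exp_neg, inv_le_iff_one_le_mul₀ (Real.exp_pos x)]
  calc (1 : ℝ) ≤ (1 - x + x ^ 2 / 2) * (1 + x + x ^ 2 / 2) := by nlinarith [sq_nonneg (x ^ 2)]
    _ ≤ (1 - x + x ^ 2 / 2) * Real.exp x := by
        gcongr
        · nlinarith [sq_nonneg (x - 1)]
        · exact Real.quadratic_le_exp_of_nonneg hx

lemma integrable_exp_neg_of_nonneg [IsFiniteMeasure P] {Z : Ω → ℝ} (hZ : AEMeasurable Z P)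
    (hZ0 : 0 ≤ Z) : Integrable (fun ω => Real.exp (-Z ω)) P := by
  refine .of_bound (by fun_prop) 1 (.of_forall fun ω => ?_)
  simpa using hZ0 ω

lemma mgf_neg_le_of_nonneg [IsProbabilityMeasure P] {Z : Ω → ℝ} (hZ : MemLp Z 2 P) (hZ0 : 0 ≤ Z)
    {t : ℝ} (ht : 0 ≤ t) : mgf (-Z) P t ≤ Real.exp (-t * P[Z] + t ^ 2 / 2 * P[Z ^ 2]) := by
  have hZ1 : Integrable (fun ω => 1 - t * Z ω) P :=
    (integrable_const 1).sub ((hZ.integrable one_le_two).const_mul t)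
  have hZ2 : Integrable (fun ω => t ^ 2 / 2 * Z ω ^ 2) P := hZ.integrable_sq.const_mul _
  calc mgf (-Z) P t = ∫ ω, Real.exp (-(t * Z ω)) ∂P := by simp [mgf]
    _ ≤ ∫ ω, (1 - t * Z ω + t ^ 2 / 2 * Z ω ^ 2) ∂P := by
        refine integral_mono (integrable_exp_neg_of_nonneg
          (hZ.aestronglyMeasurable.aemeasurable.const_mul t) fun ω => mul_nonneg ht (hZ0 ω))
          (hZ1.add hZ2) fun ω => ?_
        linarith [exp_neg_le_one_sub_add_sq_div_two (mul_nonneg ht (hZ0 ω)), mul_pow t (Z ω) 2]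
    _ = -t * P[Z] + t ^ 2 / 2 * P[Z ^ 2] + 1 := by
        rw [integral_add hZ1 hZ2, integral_sub (integrable_const 1)
          ((hZ.integrable one_le_two).const_mul t), integral_const_mul, integral_const_mul]
        simp only [integral_const, probReal_univ, smul_eq_mul, Pi.pow_apply]
        ring
    _ ≤ _ := Real.add_one_le_exp _

lemma measureReal_sum_le_le_exp_of_nonneg [IsProbabilityMeasure P] (hY : iIndepFun Y P)
    (hL2 : ∀ i, MemLp (Y i) 2 P) (hY0 : ∀ i, 0 ≤ Y i) {b M : ℝ} (hM : 0 < M)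
    (hmean : ∀ i, b ≤ P[Y i]) (hsq : ∀ i, P[Y i ^ 2] ≤ M) {s : ℝ} (hs : 0 ≤ s) :
    P.real {ω | ∑ i, Y i ω ≤ Fintype.card ι * (b - s)} ≤
      Real.exp (-(Fintype.card ι * (s ^ 2 / (2 * M)))) := by
  have hmeas i : AEMeasurable (Y i) P := (hL2 i).aestronglyMeasurable.aemeasurable
  have ht : 0 ≤ s / M := by positivity
  have hneg : iIndepFun (fun i => -Y i) P := hY.comp (fun _ x => -x) fun _ => measurable_neg
  have hint i : Integrable (fun ω => Real.exp (s / M * (-Y i) ω)) P := by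
    simpa using integrable_exp_neg_of_nonneg ((hmeas i).const_mul (s / M))
      fun ω => mul_nonneg ht (hY0 i ω)
  have hmgf i : mgf (-Y i) P (s / M) ≤ Real.exp (-(s / M) * b + (s / M) ^ 2 / 2 * M) := by
    refine (mgf_neg_le_of_nonneg (hL2 i) (hY0 i) ht).trans (Real.exp_le_exp.2 ?_)
    rw [neg_mul, neg_mul]
    gcongr
    exacts [hmean i, hsq i]
  have key := measureReal_le_sum_le_exp hneg (fun i => (hmeas i).neg) ht hint hmgf (s - b)
  convert key using 2
  · ext ω
    simp only [Set.mem_ofPred_eq, Pi.neg_apply, Finset.sum_neg_distrib]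
    constructor <;> intro h <;> linarith
  · field_simp
    ring

end Chernoff

section Gaussian

lemma gaussianPDFReal_mul_exp_mul_sq (u x : ℝ) :
    gaussianPDFReal 0 1 x * Real.exp (u * x ^ 2) =
      (√(2 * Real.pi))⁻¹ * Real.exp (-(1 / 2 - u) * x ^ 2) := by
  simp only [gaussianPDFReal, NNReal.coe_one, mul_one, sub_zero]
  rw [mul_assoc, ← Real.exp_add]
  ring_nf

lemma integrable_exp_mul_sq_gaussianReal {u : ℝ} (hu : u < 1 / 2) :
    Integrable (fun x => Real.exp (u * x ^ 2)) (gaussianReal 0 1) := by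
  rw [gaussianReal_of_var_ne_zero _ one_ne_zero, gaussianPDF_def,
    integrable_withDensity_iff_integrable_smul' (by fun_prop) (by simp)]
  simp only [ENNReal.toReal_ofReal (gaussianPDFReal_nonneg _ _ _), smul_eq_mul,
    gaussianPDFReal_mul_exp_mul_sq]
  exact (integrable_exp_neg_mul_sq (by linarith)).const_mul _

lemma integral_exp_mul_sq_gaussianReal {u : ℝ} (hu : u < 1 / 2) :
    ∫ x, Real.exp (u * x ^ 2) ∂(gaussianReal 0 1) = (√(1 - 2 * u))⁻¹ := by
  have : 1 - 2 * u ≠ 0 := by linarith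
  have : 1 / 2 - u ≠ 0 := by linarith
  simp only [integral_gaussianReal_eq_integral_smul one_ne_zero, smul_eq_mul,
    gaussianPDFReal_mul_exp_mul_sq]
  rw [integral_const_mul, integral_gaussian, ← Real.sqrt_inv, ← Real.sqrt_inv,
    ← Real.sqrt_mul (by positivity)]
  congr 1
  field_simp

lemma inv_sqrt_one_sub_two_mul_le_exp {u : ℝ} (h0 : 0 ≤ u) (hu : u ≤ 1 / 4) :
    (√(1 - 2 * u))⁻¹ ≤ Real.exp (u + 2 * u ^ 2) := by
  have h1 : 0 < 1 - 2 * u := by linarith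
  have hinv : (1 - 2 * u)⁻¹ ≤ Real.exp (u + 2 * u ^ 2) ^ 2 := by
    rw [← Real.exp_nat_mul, inv_le_iff_one_le_mul₀ h1]
    calc (1 : ℝ) ≤ (1 - 2 * u) * (1 + 2 * (u + 2 * u ^ 2) + (2 * (u + 2 * u ^ 2)) ^ 2 / 2) := by
          have h2 : 0 ≤ u ^ 2 * (1 / 4 - u) := mul_nonneg (sq_nonneg u) (by linarith)
          nlinarith [mul_nonneg h2 h0, mul_nonneg h2 (sq_nonneg u), pow_nonneg h0 3]
      _ ≤ (1 - 2 * u) * Real.exp (2 * (u + 2 * u ^ 2)) := by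
          gcongr
          exact Real.quadratic_le_exp_of_nonneg (by positivity)
      _ = Real.exp ((2 : ℕ) * (u + 2 * u ^ 2)) * (1 - 2 * u) := by
          rw [mul_comm, Nat.cast_two]
  rw [← Real.sqrt_inv]
  exact Real.sqrt_le_iff.2 ⟨(Real.exp_pos _).le, hinv⟩

lemma integral_sq_gaussianReal : ∫ x, x ^ 2 ∂(gaussianReal 0 1) = 1 := by
  have h := variance_fun_id_gaussianReal (μ := 0) (v := 1)
  rwa [variance_of_integral_eq_zero (by fun_prop) integral_id_gaussianReal] at h

lemma integral_pow_four_gaussianReal_le : ∫ x, x ^ 4 ∂(gaussianReal 0 1) ≤ 48 := by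
  have hsqrt : (2 / 3 : ℝ) ≤ √(1 - 2 * (1 / 4)) := Real.le_sqrt_of_sq_le (by norm_num)
  calc ∫ x, x ^ 4 ∂(gaussianReal 0 1)
      ≤ ∫ x, 32 * Real.exp (1 / 4 * x ^ 2) ∂(gaussianReal 0 1) := by
        refine integral_mono_of_nonneg (.of_forall fun x => by positivity)
          ((integrable_exp_mul_sq_gaussianReal (by norm_num)).const_mul _)
          (.of_forall fun x => ?_)
        have := Real.quadratic_le_exp_of_nonneg (x := 1 / 4 * x ^ 2) (by positivity)
        nlinarith [sq_nonneg x]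
    _ = 32 * (√(1 - 2 * (1 / 4)))⁻¹ := by
        rw [integral_const_mul, integral_exp_mul_sq_gaussianReal (by norm_num)]
    _ ≤ 32 * (2 / 3)⁻¹ := by gcongr
    _ = 48 := by norm_num

end Gaussian

section Rotation

variable {E : Type*} [NormedAddCommGroup E] [NormedSpace ℝ E] {f : E → ℝ} {K : ℝ≥0}

lemma rotation_add_apply (θ θ' : ℝ) (z : E × E) :
    ContinuousLinearMap.rotation (θ + θ') z =
      ContinuousLinearMap.rotation θ' (ContinuousLinearMap.rotation θ z) := by
  simp only [ContinuousLinearMap.rotation_apply, Real.cos_add, Real.sin_add]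
  ext <;> module

lemma abs_sub_pow_succ_le_sum_rotation (f : E → ℝ) (z : E × E) (n : ℕ) {N : ℕ} (hN : N ≠ 0) :
    |f z.1 - f z.2| ^ (n + 1) ≤ (N : ℝ) ^ n * ∑ i ∈ Finset.range N,
      |f (ContinuousLinearMap.rotation (π / 2 / N)
          (ContinuousLinearMap.rotation (i * (π / 2 / N)) z)).1 -
        f (ContinuousLinearMap.rotation (i * (π / 2 / N)) z).1| ^ (n + 1) := by
  set θ : ℝ := π / 2 / N with hθ
  have hNθ : (N : ℝ) * θ = π / 2 := by rw [hθ]; field_simp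
  have telescope : ∑ i ∈ Finset.range N,
      (f (ContinuousLinearMap.rotation θ (ContinuousLinearMap.rotation (i * θ) z)).1 -
        f (ContinuousLinearMap.rotation (i * θ) z).1) = f z.2 - f z.1 := by
    have h := Finset.sum_range_sub (fun i : ℕ => f (ContinuousLinearMap.rotation (i * θ) z).1) N
    simp only [Nat.cast_add, Nat.cast_one, add_mul, one_mul, rotation_add_apply, hNθ] at h
    rw [h]
    simp [ContinuousLinearMap.rotation_apply]
  have power_mean := pow_sum_div_card_le_sum_pow (s := Finset.range N)
    (f := fun i : ℕ => |f (ContinuousLinearMap.rotation θ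
      (ContinuousLinearMap.rotation (i * θ) z)).1 -
        f (ContinuousLinearMap.rotation (i * θ) z).1|) (fun i _ => abs_nonneg _) n
  rw [Finset.card_range, div_le_iff₀' (by positivity)] at power_mean
  refine le_trans (pow_le_pow_left₀ (abs_nonneg _) ?_ _) power_mean
  rw [abs_sub_comm, ← telescope]
  exact Finset.abs_sum_le_sum_abs _ _

lemma abs_comp_rotation_sub_le (hf : LipschitzWith K f) {θ : ℝ} (hθ : 0 ≤ θ) (z : E × E) :
    |f (ContinuousLinearMap.rotation θ z).1 - f z.1| ≤ θ * (K * (‖z.1‖ + ‖z.2‖)) := by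
  have hcos : |Real.cos θ - 1| ≤ θ := by
    simpa [abs_of_nonneg hθ] using Real.abs_cos_sub_cos_le θ 0
  have hsin : |Real.sin θ| ≤ θ := Real.abs_sin_le_abs.trans_eq (abs_of_nonneg hθ)
  calc |f (ContinuousLinearMap.rotation θ z).1 - f z.1|
      ≤ K * ‖(Real.cos θ - 1) • z.1 + Real.sin θ • z.2‖ := by
        have hsub : (ContinuousLinearMap.rotation θ z).1 - z.1 =
            (Real.cos θ - 1) • z.1 + Real.sin θ • z.2 := by
          rw [ContinuousLinearMap.rotation_apply]
          module
        exact hsub ▸ hf.norm_sub_le _ _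
    _ ≤ K * (|Real.cos θ - 1| * ‖z.1‖ + |Real.sin θ| * ‖z.2‖) := by
        gcongr
        exact (norm_add_le _ _).trans_eq (by simp only [norm_smul, Real.norm_eq_abs])
    _ ≤ K * (θ * ‖z.1‖ + θ * ‖z.2‖) := by gcongr
    _ = θ * (K * (‖z.1‖ + ‖z.2‖)) := by ring

lemma hasDerivAt_comp_rotation_zero {z : E × E} (hz : DifferentiableAt ℝ f z.1) :
    HasDerivAt (fun θ => f (ContinuousLinearMap.rotation θ z).1) (fderiv ℝ f z.1 z.2) 0 := by
  have hrot : HasDerivAt (fun θ => (ContinuousLinearMap.rotation θ z).1) z.2 0 := by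
    simpa [ContinuousLinearMap.rotation_apply] using
      ((Real.hasDerivAt_cos 0).smul_const z.1).fun_add
      ((Real.hasDerivAt_sin 0).smul_const z.2)
  refine HasFDerivAt.comp_hasDerivAt (f := fun θ => (ContinuousLinearMap.rotation θ z).1)
    (0 : ℝ) ?_ hrot
  simpa [ContinuousLinearMap.rotation_apply] using hz.hasFDerivAt

lemma tendsto_mul_comp_rotation_sub {z : E × E} (hz : DifferentiableAt ℝ f z.1) :
    Filter.Tendsto
      (fun N : ℕ => (N : ℝ) * (f (ContinuousLinearMap.rotation (π / 2 / N) z).1 - f z.1))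
      Filter.atTop (𝓝 (π / 2 * fderiv ℝ f z.1 z.2)) := by
  have hangle : Filter.Tendsto (fun N : ℕ => π / 2 / (N : ℝ)) Filter.atTop (𝓝[≠] 0) := by
    refine tendsto_nhdsWithin_iff.2 ⟨tendsto_const_div_atTop_nhds_zero_nat (π / 2), ?_⟩
    filter_upwards [Filter.eventually_gt_atTop 0] with N hN
    exact (by positivity : π / 2 / (N : ℝ) ≠ 0)
  refine (((hasDerivAt_comp_rotation_zero hz).tendsto_slope_zero.comp hangle).const_mul
    (π / 2)).congr fun N => ?_
  have hπ := Real.pi_ne_zero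
  simp only [Function.comp_apply, zero_add, ContinuousLinearMap.rotation_apply, Real.cos_zero,
    Real.sin_zero, one_smul, zero_smul, add_zero, smul_eq_mul]
  field_simp

end Rotation

section MaureyPisier

variable {E : Type*} [NormedAddCommGroup E] [NormedSpace ℝ E] [MeasurableSpace E] [BorelSpace E]
  [SecondCountableTopology E] [CompleteSpace E] {μ : Measure E} [IsGaussian μ] {f : E → ℝ}
  {K : ℝ≥0}

lemma measurePreserving_rotation (hμ : μ[id] = 0) (θ : ℝ) :
    MeasurePreserving (ContinuousLinearMap.rotation (E := E) θ) (μ.prod μ) (μ.prod μ) :=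
  ⟨by fun_prop, IsGaussian.map_rotation_eq_self hμ θ⟩

lemma memLp_comp_rotation_fst (hμ : μ[id] = 0) {p : ENNReal} (hf : MemLp f p μ) (θ : ℝ) :
    MemLp (fun z : E × E => f (ContinuousLinearMap.rotation θ z).1) p (μ.prod μ) :=
  (hf.comp_measurePreserving measurePreserving_fst).comp_measurePreserving
    (measurePreserving_rotation hμ θ)

lemma integral_comp_rotation (hμ : μ[id] = 0) (θ : ℝ) {g : E × E → ℝ}
    (hg : AEStronglyMeasurable g (μ.prod μ)) :
    ∫ z, g (ContinuousLinearMap.rotation θ z) ∂(μ.prod μ) = ∫ z, g z ∂(μ.prod μ) := by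
  have hrot := measurePreserving_rotation hμ θ
  rw [← integral_map hrot.aemeasurable (by rwa [hrot.map_eq]), hrot.map_eq]

lemma integrable_pow_of_memLp {α : Type*} [MeasurableSpace α] {ν : Measure α} [IsFiniteMeasure ν]
    {g : α → ℝ} {n : ℕ} (hg : MemLp g n ν) : Integrable (fun x => g x ^ n) ν :=
  hg.integrable_norm_pow'.mono (hg.1.pow n) (by simp)

/-- The rotation by `π / 2` takes `z.1` to `z.2`; the `N` equal steps into which it is split have
increments of the same law. -/
lemma integral_abs_sub_pow_le_rotation (hμ : μ[id] = 0) {n : ℕ} (hf : MemLp f n μ) {N : ℕ}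
    (hN : N ≠ 0) :
    ∫ z, |f z.1 - f z.2| ^ n ∂(μ.prod μ) ≤
      ∫ z, |N * (f (ContinuousLinearMap.rotation (π / 2 / N) z).1 - f z.1)| ^ n ∂(μ.prod μ) := by
  rcases n with _ | n
  · simp
  set θ : ℝ := π / 2 / N
  set increment : E × E → ℝ := fun z => f (ContinuousLinearMap.rotation θ z).1 - f z.1
  have hmem : MemLp increment (n + 1 : ℕ) (μ.prod μ) :=
    (memLp_comp_rotation_fst hμ hf θ).sub (hf.comp_measurePreserving measurePreserving_fst)
  have hint (i : ℕ) : Integrable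
      (fun z => |increment (ContinuousLinearMap.rotation (i * θ) z)| ^ (n + 1)) (μ.prod μ) :=
    integrable_pow_of_memLp
      (hmem.comp_measurePreserving (measurePreserving_rotation hμ (i * θ))).abs
  have hpow : AEStronglyMeasurable (fun z => |increment z| ^ (n + 1)) (μ.prod μ) :=
    (integrable_pow_of_memLp hmem.abs).aestronglyMeasurable
  calc ∫ z, |f z.1 - f z.2| ^ (n + 1) ∂(μ.prod μ)
      ≤ ∫ z, (N : ℝ) ^ n * ∑ i ∈ Finset.range N,
          |increment (ContinuousLinearMap.rotation (i * θ) z)| ^ (n + 1) ∂(μ.prod μ) :=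
        integral_mono_of_nonneg (.of_forall fun z => by positivity)
          ((integrable_finsetSum _ fun i _ => hint i).const_mul _)
          (.of_forall fun z => abs_sub_pow_succ_le_sum_rotation f z n hN)
    _ = (N : ℝ) ^ (n + 1) * ∫ z, |increment z| ^ (n + 1) ∂(μ.prod μ) := by
        rw [integral_const_mul, integral_finsetSum _ fun i _ => hint i]
        simp_rw [integral_comp_rotation hμ _ hpow]
        rw [Finset.sum_const, Finset.card_range, nsmul_eq_mul]
        ring
    _ = ∫ z, |N * increment z| ^ (n + 1) ∂(μ.prod μ) := by
        simp only [abs_mul, mul_pow, integral_const_mul, Nat.abs_cast]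

lemma memLp_of_lipschitzWith (hf : LipschitzWith K f) {p : ENNReal} (hp : p ≠ ⊤) :
    MemLp f p μ := by
  have hsub : MemLp (fun x => f x - f 0) p μ := by
    refine (IsGaussian.memLp_id μ p hp).of_le_mul (c := K)
      (hf.continuous.aestronglyMeasurable.sub aestronglyMeasurable_const)
      (.of_forall fun x => ?_)
    simpa using hf.norm_sub_le x 0
  exact (hsub.add (memLp_const (f 0))).ae_eq (.of_forall fun x => sub_add_cancel (f x) (f 0))

/-- The Maurey–Pisier inequality, obtained by letting the number of steps tend to infinity in
`integral_abs_sub_pow_le_rotation`. -/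
lemma integral_abs_sub_pow_le_integral_fderiv (hμ : μ[id] = 0) (hf : LipschitzWith K f)
    (hdiff : ∀ᵐ x ∂μ, DifferentiableAt ℝ f x) (n : ℕ) :
    ∫ z, |f z.1 - f z.2| ^ n ∂(μ.prod μ) ≤
      ∫ z, |π / 2 * fderiv ℝ f z.1 z.2| ^ n ∂(μ.prod μ) := by
  have hbound_mem : MemLp (fun z : E × E => π / 2 * (K * (‖z.1‖ + ‖z.2‖))) n (μ.prod μ) := by
    have hnorm : MemLp (fun x : E => ‖x‖) n μ :=
      (IsGaussian.memLp_id μ n (ENNReal.natCast_ne_top n)).norm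
    exact (((hnorm.comp_measurePreserving measurePreserving_fst).add
      (hnorm.comp_measurePreserving measurePreserving_snd)).const_mul _).const_mul _
  have htendsto : Filter.Tendsto (fun N : ℕ => ∫ z,
      |N * (f (ContinuousLinearMap.rotation (π / 2 / N) z).1 - f z.1)| ^ n ∂(μ.prod μ))
      Filter.atTop (𝓝 (∫ z, |π / 2 * fderiv ℝ f z.1 z.2| ^ n ∂(μ.prod μ))) := by
    refine tendsto_integral_of_dominated_convergence _ (fun N => ?_)
      (integrable_pow_of_memLp hbound_mem.abs) (fun N => .of_forall fun z => ?_) ?_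
    · have := hf.continuous
      exact Continuous.aestronglyMeasurable (by fun_prop)
    · rw [norm_pow, norm_abs_eq_norm, Real.norm_eq_abs, abs_mul, Nat.abs_cast]
      refine pow_le_pow_left₀ (by positivity) ?_ n
      calc N * |f (ContinuousLinearMap.rotation (π / 2 / N) z).1 - f z.1|
          ≤ N * (π / 2 / N * (K * (‖z.1‖ + ‖z.2‖))) := by
            gcongr
            exact abs_comp_rotation_sub_le hf (by positivity) z
        _ = N / N * (π / 2 * (K * (‖z.1‖ + ‖z.2‖))) := by ring
        _ ≤ |π / 2 * (K * (‖z.1‖ + ‖z.2‖))| := by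
            rw [abs_of_nonneg (by positivity)]
            exact mul_le_of_le_one_left (by positivity) (div_self_le_one _)
    · filter_upwards [Measure.quasiMeasurePreserving_fst.ae hdiff] with z hz
      exact (tendsto_mul_comp_rotation_sub hz).abs.pow n
  refine ge_of_tendsto htendsto ?_
  filter_upwards [Filter.eventually_ne_atTop 0] with N hN
  exact integral_abs_sub_pow_le_rotation hμ
    (memLp_of_lipschitzWith hf (ENNReal.natCast_ne_top n)) hN

end MaureyPisier

section StdGaussian

variable {E : Type*} [NormedAddCommGroup E] [InnerProductSpace ℝ E] [FiniteDimensional ℝ E]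
  [MeasurableSpace E] [BorelSpace E]

lemma stdGaussian_eq_withDensity :
    stdGaussian E = volume.withDensity fun x : E =>
      ENNReal.ofReal
        (((2 * π) ^ (Module.finrank ℝ E / 2 : ℝ))⁻¹ * Real.exp (-(1 / 2) * ‖x‖ ^ 2)) := by
  set c := (2 * π) ^ (Module.finrank ℝ E / 2 : ℝ) with hc
  have hc0 : 0 < c := by positivity
  have hint : Integrable (fun x : E => Real.exp (-(1 / 2) * ‖x‖ ^ 2)) := by
    refine .of_integral_ne_zero ?_
    rw [GaussianFourier.integral_rexp_neg_mul_sq_norm one_half_pos]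
    positivity
  have hfin := isFiniteMeasure_withDensity_ofReal (hint.const_mul c⁻¹).hasFiniteIntegral
  refine Measure.ext_of_charFun (funext fun t => ?_)
  have key := GaussianFourier.integral_cexp_neg_mul_sq_norm_add (V := E) (b := 1 / 2)
    (by norm_num) Complex.I t
  have hcc : ((π : ℂ) / (1 / 2)) ^ (Module.finrank ℝ E / 2 : ℂ) = (c : ℂ) := by
    rw [hc, Complex.ofReal_cpow (by positivity)]
    push_cast
    congr 1
    ring
  rw [charFun_stdGaussian, charFun_apply, integral_withDensity_eq_integral_toReal_smul
    (by fun_prop) (by simp)]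
  have hintegrand (x : E) :
      (ENNReal.ofReal (c⁻¹ * Real.exp (-(1 / 2) * ‖x‖ ^ 2))).toReal •
        Complex.exp (⟪x, t⟫ * Complex.I) =
      (c : ℂ)⁻¹ * Complex.exp (-(1 / 2) * ‖x‖ ^ 2 + Complex.I * ⟪t, x⟫) := by
    rw [ENNReal.toReal_ofReal (by positivity), Complex.exp_add, Complex.real_smul,
      real_inner_comm, mul_comm Complex.I]
    push_cast
    ring
  simp only [hintegrand, integral_const_mul, key, hcc]
  rw [inv_mul_cancel_left₀ (by exact_mod_cast hc0.ne'), Complex.I_sq]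
  congr 1
  ring

lemma stdGaussian_absolutelyContinuous : stdGaussian E ≪ volume := by
  rw [stdGaussian_eq_withDensity]
  exact withDensity_absolutelyContinuous _ _

lemma map_inner_stdGaussian (a : E) :
    (stdGaussian E).map (fun w => ⟪a, w⟫) = (gaussianReal 0 1).map (‖a‖ * ·) := by
  have h := IsGaussian.map_eq_gaussianReal (μ := stdGaussian E) (innerSL ℝ a)
  rw [integral_strongDual_stdGaussian, variance_dual_stdGaussian, innerSL_apply_norm] at h
  rw [gaussianReal_map_const_mul, mul_zero, mul_one]
  simpa [Real.toNNReal_of_nonneg (sq_nonneg ‖a‖)] using h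

lemma integral_comp_inner_stdGaussian (a : E) {φ : ℝ → ℝ} (hφ : Measurable φ) :
    ∫ w, φ ⟪a, w⟫ ∂(stdGaussian E) = ∫ x, φ (‖a‖ * x) ∂(gaussianReal 0 1) := by
  rw [← integral_map (φ := fun w => ⟪a, w⟫) (by fun_prop) hφ.aestronglyMeasurable,
    map_inner_stdGaussian, integral_map (by fun_prop) hφ.aestronglyMeasurable]

lemma integrable_comp_inner_stdGaussian (a : E) {φ : ℝ → ℝ} (hφ : Measurable φ) :
    Integrable (fun w => φ ⟪a, w⟫) (stdGaussian E) ↔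
      Integrable (fun x => φ (‖a‖ * x)) (gaussianReal 0 1) := by
  have h := integrable_map_measure (f := fun w : E => ⟪a, w⟫) (μ := stdGaussian E)
    hφ.aestronglyMeasurable (by fun_prop)
  rw [map_inner_stdGaussian, integrable_map_measure hφ.aestronglyMeasurable (by fun_prop)] at h
  exact h.symm

lemma memLp_inner_stdGaussian (a : E) {p : ENNReal} (hp : p ≠ ⊤) :
    MemLp (fun w => ⟪a, w⟫) p (stdGaussian E) :=
  IsGaussian.memLp_dual _ (innerSL ℝ a) p hp

lemma integral_inner_pow_four_stdGaussian_le (a : E) :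
    ∫ w, ⟪a, w⟫ ^ 4 ∂(stdGaussian E) ≤ 48 * ‖a‖ ^ 4 := by
  rw [integral_comp_inner_stdGaussian a (φ := fun t => t ^ 4) (by fun_prop)]
  simp only [mul_pow, integral_const_mul]
  rw [mul_comm]
  gcongr
  exact integral_pow_four_gaussianReal_le

lemma integral_dual_pow_four_stdGaussian_le (L : StrongDual ℝ E) :
    ∫ w, L w ^ 4 ∂(stdGaussian E) ≤ 48 * ‖L‖ ^ 4 := by
  simpa using integral_inner_pow_four_stdGaussian_le ((InnerProductSpace.toDual ℝ E).symm L)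

lemma integral_fderiv_pow_four_stdGaussian_le {f : E → ℝ} {K : ℝ≥0} (hf : LipschitzWith K f) :
    ∫ z, fderiv ℝ f z.1 z.2 ^ 4 ∂((stdGaussian E).prod (stdGaussian E)) ≤ 48 * K ^ 4 := by
  have hK (x : E) : ‖fderiv ℝ f x‖ ≤ K := norm_fderiv_le_of_lipschitz ℝ hf
  have hmeas : Measurable fun z : E × E => fderiv ℝ f z.1 z.2 :=
    isBoundedBilinearMap_apply.continuous.measurable.comp
      (((measurable_fderiv ℝ f).comp measurable_fst).prodMk measurable_snd)
  have hint : Integrable (fun z : E × E => fderiv ℝ f z.1 z.2 ^ 4)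
      ((stdGaussian E).prod (stdGaussian E)) := by
    have hbound : Integrable (fun z : E × E => (K * ‖z.2‖) ^ 4)
        ((stdGaussian E).prod (stdGaussian E)) := by
      simp only [mul_pow]
      exact ((IsGaussian.memLp_id (stdGaussian E) 4 (by simp)).integrable_norm_pow
        (by norm_num)).comp_snd _ |>.const_mul _
    refine hbound.mono' (hmeas.pow_const 4).aestronglyMeasurable (.of_forall fun z => ?_)
    rw [norm_pow]
    gcongr
    exact (fderiv ℝ f z.1).le_of_opNorm_le (hK z.1) z.2
  calc ∫ z, fderiv ℝ f z.1 z.2 ^ 4 ∂((stdGaussian E).prod (stdGaussian E))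
      = ∫ x, ∫ y, fderiv ℝ f x y ^ 4 ∂(stdGaussian E) ∂(stdGaussian E) := integral_prod _ hint
    _ ≤ ∫ _, 48 * (K : ℝ) ^ 4 ∂(stdGaussian E) := by
        refine integral_mono hint.integral_prod_left (integrable_const _) fun x => ?_
        refine (integral_dual_pow_four_stdGaussian_le _).trans ?_
        gcongr
        exact hK x
    _ = 48 * K ^ 4 := by simp

lemma integral_sub_pow_four_stdGaussian_le {f : E → ℝ} {K : ℝ≥0} (hf : LipschitzWith K f) :
    ∫ z, (f z.1 - f z.2) ^ 4 ∂((stdGaussian E).prod (stdGaussian E)) ≤ 336 * K ^ 4 := by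
  have heven : Even 4 := by decide
  have hpi : (π / 2) ^ 4 ≤ 7 := by
    calc (π / 2) ^ 4 ≤ (3.15 / 2) ^ 4 := by gcongr; exact Real.pi_lt_d2.le
      _ ≤ 7 := by norm_num
  have hdiff : ∀ᵐ x ∂(stdGaussian E), DifferentiableAt ℝ f x :=
    stdGaussian_absolutelyContinuous.ae_le hf.ae_differentiableAt
  have key := integral_abs_sub_pow_le_integral_fderiv integral_id_stdGaussian hf hdiff 4
  simp only [heven.pow_abs, mul_pow, integral_const_mul] at key
  calc _ ≤ _ := key
    _ ≤ 7 * (48 * (K : ℝ) ^ 4) := by gcongr; exact integral_fderiv_pow_four_stdGaussian_le hf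
    _ = 336 * K ^ 4 := by ring

lemma pow_four_le_sub_pow_four_add (a b : ℝ) : a ^ 4 ≤ 4 * (a - b) ^ 4 + 4 * (a ^ 2 * b ^ 2) := by
  nlinarith [sq_nonneg (a ^ 2 - 2 * (a - b) ^ 2), sq_nonneg (a * (a - 2 * b))]

lemma integral_pow_four_stdGaussian_le {f : E → ℝ} {K : ℝ≥0} (hf : LipschitzWith K f) :
    ∫ x, f x ^ 4 ∂(stdGaussian E) ≤
      1344 * K ^ 4 + 4 * (∫ x, f x ^ 2 ∂(stdGaussian E)) ^ 2 := by
  set μ := stdGaussian E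
  have hf4 : MemLp f 4 μ := memLp_of_lipschitzWith hf (by simp)
  have hsub : Integrable (fun z : E × E => (f z.1 - f z.2) ^ 4) (μ.prod μ) :=
    integrable_pow_of_memLp ((hf4.comp_fst μ).sub (hf4.comp_snd μ))
  have hsq : Integrable (fun x => f x ^ 2) μ := (hf4.mono_exponent (by norm_num)).integrable_sq
  calc ∫ x, f x ^ 4 ∂μ
      = ∫ z, f z.1 ^ 4 ∂(μ.prod μ) := by
        simpa using (integral_fun_fst (μ := μ) (ν := μ) fun x => f x ^ 4).symm
    _ ≤ ∫ z, 4 * (f z.1 - f z.2) ^ 4 + 4 * (f z.1 ^ 2 * f z.2 ^ 2) ∂(μ.prod μ) := by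
        refine integral_mono ((integrable_pow_of_memLp hf4).comp_fst μ)
          ((hsub.const_mul 4).add ((hsq.mul_prod hsq).const_mul 4))
          fun z => pow_four_le_sub_pow_four_add _ _
    _ = 4 * ∫ z, (f z.1 - f z.2) ^ 4 ∂(μ.prod μ) + 4 * (∫ x, f x ^ 2 ∂μ) ^ 2 := by
        rw [integral_add (hsub.const_mul 4) ((hsq.mul_prod hsq).const_mul 4), integral_const_mul,
          integral_const_mul, integral_prod_mul (fun x => f x ^ 2) (fun x => f x ^ 2),
          sq (∫ x, _ ∂μ)]
    _ ≤ 4 * (336 * K ^ 4) + 4 * (∫ x, f x ^ 2 ∂μ) ^ 2 := by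
        gcongr
        exact integral_sub_pow_four_stdGaussian_le hf
    _ = 1344 * K ^ 4 + 4 * (∫ x, f x ^ 2 ∂μ) ^ 2 := by ring

lemma integral_comp_inner_mul_inner_of_inner_eq_zero {a z : E} (h : ⟪a, z⟫ = 0) (g : ℝ → ℝ) :
    ∫ w, g ⟪a, w⟫ * ⟪z, w⟫ ∂(stdGaussian E) = 0 := by
  set R := (ℝ ∙ z)ᗮ.reflection
  have hRa (w : E) : ⟪a, R w⟫ = ⟪a, w⟫ := by
    have ha : R a = a := Submodule.reflection_mem_subspace_eq_self
      (Submodule.mem_orthogonal_singleton_iff_inner_left.2 h)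
    rw [← R.inner_map_map a w, ha]
  have hRz (w : E) : ⟪z, R w⟫ = -⟪z, w⟫ := by
    have hz : R z = -z := Submodule.reflection_orthogonalComplement_singleton_eq_neg z
    rw [← R.inner_map_map z w, hz, inner_neg_left, neg_neg]
  have hmap : ∫ w, g ⟪a, R w⟫ * ⟪z, R w⟫ ∂(stdGaussian E) =
      ∫ w, g ⟪a, w⟫ * ⟪z, w⟫ ∂(stdGaussian E) := by
    have := (⟨R.continuous.measurable, stdGaussian_map R⟩ :
      MeasurePreserving R (stdGaussian E) (stdGaussian E)).integral_comp
      R.toHomeomorph.measurableEmbedding (fun w => g ⟪a, w⟫ * ⟪z, w⟫)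
    exact this
  simp only [hRa, hRz, mul_neg, integral_neg] at hmap
  linarith

lemma integral_comp_inner_mul_inner_stdGaussian (a b : E) {g : ℝ → ℝ} (hg : Measurable g)
    (hg2 : MemLp (fun w => g ⟪a, w⟫) 2 (stdGaussian E)) :
    ∫ w, g ⟪a, w⟫ * ⟪b, w⟫ ∂(stdGaussian E) =
      ⟪a, b⟫ / ‖a‖ * ∫ x, g (‖a‖ * x) * x ∂(gaussianReal 0 1) := by
  set c := ⟪a, b⟫ / ‖a‖ ^ 2 with hc
  have horth : ⟪a, b - c • a⟫ = 0 := by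
    rw [inner_sub_right, inner_smul_right, real_inner_self_eq_norm_sq, hc]
    rcases eq_or_ne a 0 with rfl | ha
    · simp
    · field_simp
      ring
  have hint (v : E) : Integrable (fun w => g ⟪a, w⟫ * ⟪v, w⟫) (stdGaussian E) :=
    hg2.integrable_mul (memLp_inner_stdGaussian (p := 2) v (by simp))
  have hself : ∫ w, g ⟪a, w⟫ * ⟪a, w⟫ ∂(stdGaussian E) =
      ‖a‖ * ∫ x, g (‖a‖ * x) * x ∂(gaussianReal 0 1) := by
    rw [integral_comp_inner_stdGaussian a (φ := fun t => g t * t) (by fun_prop),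
      ← integral_const_mul]
    exact integral_congr_ae (.of_forall fun x => by ring)
  calc ∫ w, g ⟪a, w⟫ * ⟪b, w⟫ ∂(stdGaussian E)
      = ∫ w, g ⟪a, w⟫ * ⟪b - c • a, w⟫ + c * (g ⟪a, w⟫ * ⟪a, w⟫) ∂(stdGaussian E) := by
        refine integral_congr_ae (.of_forall fun w => ?_)
        simp only [inner_sub_left, real_inner_smul_left]
        ring
    _ = c * (‖a‖ * ∫ x, g (‖a‖ * x) * x ∂(gaussianReal 0 1)) := by
        rw [integral_add (hint _) ((hint a).const_mul c), integral_const_mul, hself,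
          integral_comp_inner_mul_inner_of_inner_eq_zero horth, zero_add]
    _ = ⟪a, b⟫ / ‖a‖ * ∫ x, g (‖a‖ * x) * x ∂(gaussianReal 0 1) := by
        rw [hc]
        rcases eq_or_ne a 0 with rfl | ha
        · simp
        · field_simp

end StdGaussian

section HermiteCoeff

lemma sq_integral_mul_le {α : Type*} [MeasurableSpace α] {μ : Measure α} {f g : α → ℝ}
    (hf : MemLp f 2 μ) (hg : MemLp g 2 μ) :
    (∫ x, f x * g x ∂μ) ^ 2 ≤ (∫ x, f x ^ 2 ∂μ) * ∫ x, g x ^ 2 ∂μ := by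
  have hfg : Integrable (fun x => f x * g x) μ := hf.integrable_mul hg
  have hquad (c : ℝ) : 0 ≤ (∫ x, f x ^ 2 ∂μ) * (c * c) + 2 * (∫ x, f x * g x ∂μ) * c +
      ∫ x, g x ^ 2 ∂μ :=
    calc 0 ≤ ∫ x, (c * f x + g x) ^ 2 ∂μ := by positivity
      _ = ∫ x, (c * c * f x ^ 2 + 2 * c * (f x * g x)) + g x ^ 2 ∂μ := by
          congr with x
          ring
      _ = _ := by
          rw [integral_add (by exact (hf.integrable_sq.const_mul _).add (hfg.const_mul _))
            hg.integrable_sq, integral_add (hf.integrable_sq.const_mul _) (hfg.const_mul _),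
            integral_const_mul, integral_const_mul]
          ring
  have := discrim_le_zero hquad
  rw [discrim] at this
  linarith

variable {σ : ℝ → ℝ} {s p : ℝ}

lemma hermiteCoeff_one (σ : ℝ → ℝ) (s : ℝ) :
    hermiteCoeff σ 1 s = ∫ x, σ (s * x) * x ∂(gaussianReal 0 1) := by
  simp [hermiteCoeff, orthoHermite]

lemma memLp_comp_mul_gaussianReal (hσ : Measurable σ) (h0 : ∀ t, |σ t| ≤ |t|) (s : ℝ) :
    MemLp (fun x => σ (s * x)) 2 (gaussianReal 0 1) :=
  ((memLp_id_gaussianReal' 2 (by simp)).const_mul s).mono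
    (hσ.comp (measurable_const_mul s)).aestronglyMeasurable (.of_forall fun _ => h0 _)

lemma sq_hermiteCoeff_one_le (hσ : Measurable σ) (h0 : ∀ t, |σ t| ≤ |t|) (s : ℝ) :
    hermiteCoeff σ 1 s ^ 2 ≤ ∫ x, σ (s * x) ^ 2 ∂(gaussianReal 0 1) := by
  have h := sq_integral_mul_le (memLp_comp_mul_gaussianReal hσ h0 s)
    (memLp_id_gaussianReal' 2 (by simp))
  simpa only [id_eq, integral_sq_gaussianReal, mul_one, hermiteCoeff_one] using h

lemma integral_sq_comp_mul_le (h0 : ∀ t, |σ t| ≤ |t|) (s : ℝ) :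
    ∫ x, σ (s * x) ^ 2 ∂(gaussianReal 0 1) ≤ s ^ 2 :=
  calc ∫ x, σ (s * x) ^ 2 ∂(gaussianReal 0 1)
      ≤ ∫ x, s ^ 2 * x ^ 2 ∂(gaussianReal 0 1) := by
        refine integral_mono_of_nonneg (.of_forall fun x => sq_nonneg _)
          ((memLp_id_gaussianReal' 2 (by simp)).integrable_sq.const_mul _)
          (.of_forall fun x => ?_)
        simpa only [mul_pow] using sq_le_sq.2 (h0 (s * x))
    _ = s ^ 2 := by rw [integral_const_mul, integral_sq_gaussianReal, mul_one]

lemma le_one_of_mul_sq_le_sq_hermiteCoeff (hσ : Measurable σ) (h0 : ∀ t, |σ t| ≤ |t|)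
    (hs : s ≠ 0) (hp : p * s ^ 2 ≤ hermiteCoeff σ 1 s ^ 2) : p ≤ 1 := by
  have hs2 : 0 < s ^ 2 := by positivity
  have := hp.trans ((sq_hermiteCoeff_one_le hσ h0 s).trans (integral_sq_comp_mul_le h0 s))
  exact le_of_mul_le_mul_right (by rwa [one_mul]) hs2

end HermiteCoeff

section Row

variable {E : Type*} [NormedAddCommGroup E] [InnerProductSpace ℝ E] {ι : Type*} [Fintype ι]
  {a : ι → E} {σ : ℝ → ℝ}

/-- The squared Euclidean norm of the vector `(σ ⟪a j, w⟫)_j`. If the `a j` are the columns of `X`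
and `w` is a row of `W`, this vector is the corresponding row of `σ(WX)`. -/
def rowSq (σ : ℝ → ℝ) (a : ι → E) (w : E) : ℝ := ∑ j, σ ⟪a j, w⟫ ^ 2

lemma rowSq_nonneg (w : E) : 0 ≤ rowSq σ a w :=
  Finset.sum_nonneg fun _ _ => sq_nonneg _

lemma comp_rowSq_div_le {φ : ℝ → ℝ} (hφ : ConvexOn ℝ (Set.Ici 0) φ)
    (hmono : MonotoneOn φ (Set.Ici 0)) (h0 : ∀ t, |σ t| ≤ |t|) (hF : 0 < ∑ j, ‖a j‖ ^ 2) (w : E) :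
    φ (rowSq σ a w / ∑ j, ‖a j‖ ^ 2) ≤
      ∑ j, ‖a j‖ ^ 2 / (∑ j, ‖a j‖ ^ 2) * φ ((⟪a j, w⟫ / ‖a j‖) ^ 2) := by
  set F := ∑ j, ‖a j‖ ^ 2 with hFdef
  have hnorm (j : ι) : ‖a j‖ ^ 2 / F * (⟪a j, w⟫ / ‖a j‖) ^ 2 = ⟪a j, w⟫ ^ 2 / F := by
    rcases eq_or_ne (a j) 0 with ha | ha
    · simp [ha]
    · field_simp
  have hrow : rowSq σ a w / F ≤ ∑ j, ‖a j‖ ^ 2 / F * (⟪a j, w⟫ / ‖a j‖) ^ 2 := by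
    simp only [hnorm, rowSq, Finset.sum_div]
    gcongr ∑ j, ?_ / F
    exact sq_le_sq.2 (h0 _)
  have hrow0 : 0 ≤ rowSq σ a w / F := div_nonneg (rowSq_nonneg w) hF.le
  refine (hmono hrow0 (hrow0.trans hrow) hrow).trans ?_
  simpa only [smul_eq_mul] using hφ.map_sum_le (t := Finset.univ)
    (w := fun j => ‖a j‖ ^ 2 / F) (p := fun j => (⟪a j, w⟫ / ‖a j‖) ^ 2)
    (fun _ _ => by positivity) (by rw [← Finset.sum_div, ← hFdef, div_self hF.ne'])
    fun _ _ => Set.mem_Ici.2 (sq_nonneg _)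

variable [FiniteDimensional ℝ E] [MeasurableSpace E] [BorelSpace E]

lemma measurable_rowSq (hσ : Measurable σ) : Measurable (rowSq σ a) := by
  unfold rowSq
  fun_prop

section Domination

variable {φ : ℝ → ℝ} (hφm : Measurable φ)

include hφm

lemma integral_mul_comp_sq_inner_div_norm (a : E) (F : ℝ) :
    ∫ w, ‖a‖ ^ 2 / F * φ ((⟪a, w⟫ / ‖a‖) ^ 2) ∂(stdGaussian E) =
      ‖a‖ ^ 2 / F * ∫ x, φ (x ^ 2) ∂(gaussianReal 0 1) := by
  rcases eq_or_ne a 0 with rfl | ha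
  · simp
  rw [integral_const_mul,
    integral_comp_inner_stdGaussian a (φ := fun t => φ ((t / ‖a‖) ^ 2)) (by fun_prop)]
  simp only [mul_div_cancel_left₀ _ (norm_ne_zero_iff.2 ha)]

variable (hint : Integrable (fun x => φ (x ^ 2)) (gaussianReal 0 1))

include hint

lemma integrable_mul_comp_sq_inner_div_norm (a : E) (F : ℝ) :
    Integrable (fun w => ‖a‖ ^ 2 / F * φ ((⟪a, w⟫ / ‖a‖) ^ 2)) (stdGaussian E) := by
  rcases eq_or_ne a 0 with rfl | ha
  · simp
  refine Integrable.const_mul ?_ _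
  rw [integrable_comp_inner_stdGaussian a (φ := fun t => φ ((t / ‖a‖) ^ 2)) (by fun_prop)]
  simpa only [mul_div_cancel_left₀ _ (norm_ne_zero_iff.2 ha)]

variable (hφ : ConvexOn ℝ (Set.Ici 0) φ) (hmono : MonotoneOn φ (Set.Ici 0))
  (hφ0 : ∀ t, 0 ≤ t → 0 ≤ φ t) (h0 : ∀ t, |σ t| ≤ |t|) (hF : 0 < ∑ j, ‖a j‖ ^ 2)

include hφ hmono hφ0 h0 hF

lemma integrable_comp_rowSq_div (hσ : Measurable σ) :
    Integrable (fun w => φ (rowSq σ a w / ∑ j, ‖a j‖ ^ 2)) (stdGaussian E) := by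
  refine (integrable_finsetSum Finset.univ fun j _ =>
    integrable_mul_comp_sq_inner_div_norm hφm hint (a j) (∑ j, ‖a j‖ ^ 2)).mono'
    (hφm.comp ((measurable_rowSq hσ).div_const _)).aestronglyMeasurable (.of_forall fun w => ?_)
  rw [Real.norm_of_nonneg (hφ0 _ (div_nonneg (rowSq_nonneg w) hF.le))]
  exact comp_rowSq_div_le hφ hmono h0 hF w

lemma integral_comp_rowSq_div_le :
    ∫ w, φ (rowSq σ a w / ∑ j, ‖a j‖ ^ 2) ∂(stdGaussian E) ≤
      ∫ x, φ (x ^ 2) ∂(gaussianReal 0 1) := by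
  set F := ∑ j, ‖a j‖ ^ 2 with hFdef
  have hint_term (j : ι) := integrable_mul_comp_sq_inner_div_norm hφm hint (a j) F
  calc ∫ w, φ (rowSq σ a w / F) ∂(stdGaussian E)
      ≤ ∫ w, ∑ j, ‖a j‖ ^ 2 / F * φ ((⟪a j, w⟫ / ‖a j‖) ^ 2) ∂(stdGaussian E) :=
        integral_mono_of_nonneg
          (.of_forall fun w => hφ0 _ (div_nonneg (rowSq_nonneg w) hF.le))
          (integrable_finsetSum _ fun j _ => hint_term j)
          (.of_forall (comp_rowSq_div_le hφ hmono h0 hF))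
    _ = (∑ j, ‖a j‖ ^ 2 / F) * ∫ x, φ (x ^ 2) ∂(gaussianReal 0 1) := by
        rw [integral_finsetSum _ fun j _ => hint_term j, Finset.sum_mul]
        simp only [integral_mul_comp_sq_inner_div_norm hφm]
    _ = ∫ x, φ (x ^ 2) ∂(gaussianReal 0 1) := by
        rw [← Finset.sum_div, ← hFdef, div_self hF.ne', one_mul]

end Domination

section Moments

variable {p θ : ℝ}

lemma integrable_sq_sq_gaussianReal : Integrable (fun x : ℝ => (x ^ 2) ^ 2) (gaussianReal 0 1) := by
  simpa [← pow_mul] using integrable_pow_of_memLp (memLp_id_gaussianReal' (4 : ℕ) (by simp))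

lemma convexOn_exp_const_mul (θ : ℝ) : ConvexOn ℝ (Set.Ici 0) fun t => Real.exp (θ * t) :=
  (convexOn_exp.comp_linearMap (LinearMap.mul ℝ ℝ θ)).subset (Set.subset_univ _) (convex_Ici 0)

lemma monotone_exp_const_mul (hθ : 0 ≤ θ) : Monotone fun t => Real.exp (θ * t) :=
  Real.exp_monotone.comp (monotone_mul_left_of_nonneg hθ)

variable (h0 : ∀ t, |σ t| ≤ |t|)

include h0

lemma memLp_comp_inner_stdGaussian (hσ : Measurable σ) (a : E) :
    MemLp (fun w => σ ⟪a, w⟫) 2 (stdGaussian E) :=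
  (memLp_inner_stdGaussian a (by simp)).mono (Measurable.aestronglyMeasurable (by fun_prop))
    (.of_forall fun _ => h0 _)

lemma mul_sum_sq_le_integral_rowSq (hσ : Measurable σ)
    (hp : ∀ j, p * ‖a j‖ ^ 2 ≤ hermiteCoeff σ 1 ‖a j‖ ^ 2) :
    p * ∑ j, ‖a j‖ ^ 2 ≤ ∫ w, rowSq σ a w ∂(stdGaussian E) := by
  simp only [rowSq]
  rw [integral_finsetSum _ fun j _ => (memLp_comp_inner_stdGaussian h0 hσ (a j)).integrable_sq,
    Finset.mul_sum]
  refine Finset.sum_le_sum fun j _ => ?_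
  rw [integral_comp_inner_stdGaussian (a j) (φ := fun t => σ t ^ 2) (by fun_prop)]
  exact (hp j).trans (sq_hermiteCoeff_one_le hσ h0 _)

variable (hF : 0 < ∑ j, ‖a j‖ ^ 2)

include hF

lemma integral_sq_rowSq_div_le :
    ∫ w, (rowSq σ a w / ∑ j, ‖a j‖ ^ 2) ^ 2 ∂(stdGaussian E) ≤ 48 := by
  have h := integral_comp_rowSq_div_le (φ := fun t => t ^ 2) (by fun_prop)
    integrable_sq_sq_gaussianReal (convexOn_pow 2) pow_left_monotoneOn (fun t _ => sq_nonneg t)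
    h0 hF
  simp only [← pow_mul] at h
  exact h.trans integral_pow_four_gaussianReal_le

lemma memLp_rowSq_div (hσ : Measurable σ) :
    MemLp (fun w => rowSq σ a w / ∑ j, ‖a j‖ ^ 2) 2 (stdGaussian E) := by
  rw [memLp_two_iff_integrable_sq ((measurable_rowSq hσ).div_const _).aestronglyMeasurable]
  exact integrable_comp_rowSq_div (φ := fun t => t ^ 2) (by fun_prop)
    integrable_sq_sq_gaussianReal (convexOn_pow 2) pow_left_monotoneOn (fun t _ => sq_nonneg t)
    h0 hF hσ

lemma integrable_exp_mul_rowSq_div (hσ : Measurable σ) (hθ0 : 0 ≤ θ) (hθ : θ < 1 / 2) :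
    Integrable (fun w => Real.exp (θ * (rowSq σ a w / ∑ j, ‖a j‖ ^ 2))) (stdGaussian E) :=
  integrable_comp_rowSq_div (φ := fun t => Real.exp (θ * t)) (by fun_prop)
    (integrable_exp_mul_sq_gaussianReal hθ) (convexOn_exp_const_mul θ)
    ((monotone_exp_const_mul hθ0).monotoneOn _) (fun t _ => (Real.exp_pos _).le) h0 hF hσ

lemma integral_exp_mul_rowSq_div_le (hθ0 : 0 ≤ θ) (hθ : θ ≤ 1 / 4) :
    ∫ w, Real.exp (θ * (rowSq σ a w / ∑ j, ‖a j‖ ^ 2)) ∂(stdGaussian E) ≤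
      Real.exp (θ + 2 * θ ^ 2) :=
  have hθ' : θ < 1 / 2 := by linarith
  calc ∫ w, Real.exp (θ * (rowSq σ a w / ∑ j, ‖a j‖ ^ 2)) ∂(stdGaussian E)
      ≤ ∫ x, Real.exp (θ * x ^ 2) ∂(gaussianReal 0 1) :=
        integral_comp_rowSq_div_le (φ := fun t => Real.exp (θ * t)) (by fun_prop)
          (integrable_exp_mul_sq_gaussianReal hθ') (convexOn_exp_const_mul θ)
          ((monotone_exp_const_mul hθ0).monotoneOn _) (fun t _ => (Real.exp_pos _).le) h0 hF
    _ = (√(1 - 2 * θ))⁻¹ := integral_exp_mul_sq_gaussianReal hθ'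
    _ ≤ Real.exp (θ + 2 * θ ^ 2) := inv_sqrt_one_sub_two_mul_le_exp hθ0 hθ

end Moments

end Row

section Feature

variable {E : Type*} [NormedAddCommGroup E] [InnerProductSpace ℝ E] {ι : Type*} [Fintype ι]
  {a : ι → E} {σ : ℝ → ℝ}

/-- The operator `y ↦ ∑ j, y j • a j` whose matrix has the columns `a j`. -/
noncomputable def columnOperator (a : ι → E) : EuclideanSpace ℝ ι →L[ℝ] E :=
  ∑ j, (EuclideanSpace.proj j).smulRight (a j)

lemma columnOperator_apply (a : ι → E) (y : EuclideanSpace ℝ ι) :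
    columnOperator a y = ∑ j, y j • a j := by
  simp [columnOperator]

lemma sum_mul_inner_eq_inner_columnOperator (u : EuclideanSpace ℝ ι) (w : E) :
    ∑ j, u j * ⟪a j, w⟫ = ⟪columnOperator a u, w⟫ := by
  simp [columnOperator_apply, sum_inner, real_inner_smul_left]

lemma sum_sq_inner_le (a : ι → E) (w : E) :
    ∑ j, ⟪a j, w⟫ ^ 2 ≤ (‖columnOperator a‖ * ‖w‖) ^ 2 := by
  set v : EuclideanSpace ℝ ι := WithLp.toLp 2 fun j => ⟪a j, w⟫ with hv
  have hsq : ‖v‖ * ‖v‖ = ∑ j, v j * ⟪a j, w⟫ := by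
    rw [← sq, EuclideanSpace.norm_sq_eq]
    exact Finset.sum_congr rfl fun j _ => by simp [hv, sq]
  have hle : ‖v‖ * ‖v‖ ≤ ‖v‖ * (‖columnOperator a‖ * ‖w‖) :=
    calc ‖v‖ * ‖v‖ = ⟪columnOperator a v, w⟫ := by
          rw [hsq, sum_mul_inner_eq_inner_columnOperator]
      _ ≤ ‖columnOperator a v‖ * ‖w‖ := real_inner_le_norm _ _
      _ ≤ ‖columnOperator a‖ * ‖v‖ * ‖w‖ := by
          gcongr
          exact (columnOperator a).le_opNorm v
      _ = ‖v‖ * (‖columnOperator a‖ * ‖w‖) := by ring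
  calc ∑ j, ⟪a j, w⟫ ^ 2 = ‖v‖ ^ 2 := by simp [hv, EuclideanSpace.real_norm_sq_eq]
    _ ≤ (‖columnOperator a‖ * ‖w‖) ^ 2 := by
        gcongr
        rcases (norm_nonneg v).eq_or_lt with h | h
        · rw [← h]
          positivity
        · exact le_of_mul_le_mul_left hle h

/-- The value at `w` of the functional with coefficients `u` applied to `(σ ⟪a j, w⟫)_j`. If the
`a j` are the columns of `X` and `w` is a row of `W`, this is an entry of `σ(WX) u`. -/
noncomputable def feature (σ : ℝ → ℝ) (a : ι → E) (u : EuclideanSpace ℝ ι) (w : E) : ℝ :=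
  ∑ j, u j * σ ⟪a j, w⟫

lemma lipschitzWith_feature (hσ : LipschitzWith 1 σ) {u : EuclideanSpace ℝ ι} (hu : ‖u‖ ≤ 1) :
    LipschitzWith ‖columnOperator a‖₊ (feature σ a u) := by
  refine LipschitzWith.of_dist_le_mul fun w w' => abs_le_of_sq_le_sq ?_ (by positivity)
  calc (feature σ a u w - feature σ a u w') ^ 2
      = (∑ j, u j * (σ ⟪a j, w⟫ - σ ⟪a j, w'⟫)) ^ 2 := by
        simp only [feature, mul_sub, Finset.sum_sub_distrib]
    _ ≤ (∑ j, u j ^ 2) * ∑ j, (σ ⟪a j, w⟫ - σ ⟪a j, w'⟫) ^ 2 := Finset.sum_mul_sq_le_sq_mul_sq ..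
    _ ≤ 1 * ∑ j, ⟪a j, w - w'⟫ ^ 2 := by
        gcongr ?_ * ∑ j, ?_ with j
        · rw [← EuclideanSpace.real_norm_sq_eq]
          exact pow_le_one₀ (norm_nonneg u) hu
        · rw [inner_sub_right]
          exact sq_le_sq.2 (by simpa [Real.dist_eq] using hσ.dist_le_mul ⟪a j, w⟫ ⟪a j, w'⟫)
    _ ≤ (‖columnOperator a‖ * dist w w') ^ 2 := by
        rw [one_mul, dist_eq_norm]
        exact sum_sq_inner_le a _

lemma exists_norm_le_one_norm_eq_opNorm {V : Type*} [NormedAddCommGroup V]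
    [NormedSpace ℝ V] [FiniteDimensional ℝ V] (T : V →L[ℝ] E) :
    ∃ y, ‖y‖ ≤ 1 ∧ ‖T y‖ = ‖T‖ := by
  obtain ⟨y, hy, hmax⟩ := (isCompact_closedBall (0 : V) 1).exists_isMaxOn ⟨0, by simp⟩
    (f := fun x => ‖T x‖) (by fun_prop)
  have hy1 : ‖y‖ ≤ 1 := by simpa using hy
  refine ⟨y, hy1, le_antisymm (T.unit_le_opNorm y hy1) ?_⟩
  exact T.opNorm_le_of_unit_norm (norm_nonneg _) fun x hx => hmax (by simp [hx])

section SecondMoment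

variable [FiniteDimensional ℝ E] [MeasurableSpace E] [BorelSpace E]

lemma integral_sq_inner_stdGaussian (v : E) : ∫ w, ⟪v, w⟫ ^ 2 ∂(stdGaussian E) = ‖v‖ ^ 2 := by
  rw [integral_comp_inner_stdGaussian v (φ := fun t => t ^ 2) (by fun_prop)]
  simp only [mul_pow, integral_const_mul, integral_sq_gaussianReal, mul_one]

lemma integral_feature_mul_inner (hσ : Measurable σ) (h0 : ∀ t, |σ t| ≤ |t|)
    (u : EuclideanSpace ℝ ι) (v : E) :
    ∫ w, feature σ a u w * ⟪v, w⟫ ∂(stdGaussian E) =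
      ∑ j, u j * (hermiteCoeff σ 1 ‖a j‖ / ‖a j‖ * ⟪a j, v⟫) := by
  have hmem (j : ι) := memLp_comp_inner_stdGaussian h0 hσ (a j)
  have hint (j : ι) : Integrable (fun w => u j * (σ ⟪a j, w⟫ * ⟪v, w⟫)) (stdGaussian E) :=
    ((hmem j).integrable_mul (memLp_inner_stdGaussian (p := 2) v (by simp))).const_mul _
  simp only [feature, Finset.sum_mul, mul_assoc]
  rw [integral_finsetSum _ fun j _ => hint j]
  refine Finset.sum_congr rfl fun j _ => ?_
  rw [integral_const_mul, integral_comp_inner_mul_inner_stdGaussian _ _ hσ (hmem j),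
    ← hermiteCoeff_one]
  ring

lemma exists_norm_le_integral_feature_mul_inner_eq (hσ : Measurable σ) (h0 : ∀ t, |σ t| ≤ |t|)
    {p : ℝ} (hp0 : 0 < p) (hp : ∀ j, p * ‖a j‖ ^ 2 ≤ hermiteCoeff σ 1 ‖a j‖ ^ 2)
    (y : EuclideanSpace ℝ ι) :
    ∃ u : EuclideanSpace ℝ ι, ‖u‖ ≤ ‖y‖ ∧ ∀ v,
      ∫ w, feature σ a u w * ⟪v, w⟫ ∂(stdGaussian E) = √p * ⟪columnOperator a y, v⟫ := by
  set h : ι → ℝ := fun j => hermiteCoeff σ 1 ‖a j‖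
  have hle (j : ι) : √p * ‖a j‖ ≤ |h j| := by
    refine Real.le_sqrt_of_sq_le ?_ |>.trans_eq (Real.sqrt_sq_eq_abs _)
    rw [mul_pow, Real.sq_sqrt hp0.le]
    exact hp j
  refine ⟨WithLp.toLp 2 fun j => y j * (√p * ‖a j‖ / h j), ?_, fun v => ?_⟩
  · rw [← sq_le_sq₀ (norm_nonneg _) (norm_nonneg _), EuclideanSpace.real_norm_sq_eq,
      EuclideanSpace.real_norm_sq_eq]
    gcongr ∑ j, ?_ with j
    have hfac : |√p * ‖a j‖ / h j| ≤ 1 := by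
      rw [abs_div, abs_of_nonneg (by positivity)]
      exact div_le_one_of_le₀ (hle j) (abs_nonneg _)
    rw [sq_le_sq, abs_mul]
    exact mul_le_of_le_one_right (abs_nonneg _) hfac
  · rw [integral_feature_mul_inner hσ h0, ← sum_mul_inner_eq_inner_columnOperator, Finset.mul_sum]
    refine Finset.sum_congr rfl fun j _ => ?_
    rcases eq_or_ne (a j) 0 with ha | ha
    · simp [ha]
    have hj : h j ≠ 0 := abs_pos.1 (lt_of_lt_of_le (by positivity) (hle j))
    change y j * (√p * ‖a j‖ / h j) * (h j / ‖a j‖ * ⟪a j, v⟫) = √p * (y j * ⟪a j, v⟫)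
    field_simp

lemma exists_mul_sq_norm_columnOperator_le_integral_feature_sq (hσ : LipschitzWith 1 σ)
    (h0 : ∀ t, |σ t| ≤ |t|) {p : ℝ} (hp0 : 0 < p)
    (hp : ∀ j, p * ‖a j‖ ^ 2 ≤ hermiteCoeff σ 1 ‖a j‖ ^ 2) :
    ∃ u : EuclideanSpace ℝ ι, ‖u‖ ≤ 1 ∧
      p * ‖columnOperator a‖ ^ 2 ≤ ∫ w, feature σ a u w ^ 2 ∂(stdGaussian E) := by
  obtain ⟨y, hy, hTy⟩ := exists_norm_le_one_norm_eq_opNorm (columnOperator a)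
  obtain ⟨u, hu, hcorr⟩ :=
    exists_norm_le_integral_feature_mul_inner_eq hσ.continuous.measurable h0 hp0 hp y
  refine ⟨u, hu.trans hy, ?_⟩
  rcases eq_or_ne (columnOperator a) 0 with hT | hT
  · rw [hT, norm_zero, zero_pow two_ne_zero, mul_zero]
    exact integral_nonneg fun w => sq_nonneg _
  have hfeature : MemLp (feature σ a u) 2 (stdGaussian E) :=
    memLp_of_lipschitzWith (lipschitzWith_feature hσ (hu.trans hy)) (by simp)
  have hCS := sq_integral_mul_le hfeature (memLp_inner_stdGaussian (columnOperator a y) (by simp))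
  rw [hcorr, real_inner_self_eq_norm_sq, integral_sq_inner_stdGaussian, hTy, mul_pow,
    Real.sq_sqrt hp0.le, sq (_ ^ 2), ← mul_assoc] at hCS
  exact le_of_mul_le_mul_right hCS (by positivity)

lemma integral_sq_feature_sq_le (hσ : LipschitzWith 1 σ) {u : EuclideanSpace ℝ ι} (hu : ‖u‖ ≤ 1)
    {p : ℝ} (hp0 : 0 < p) (hp1 : p ≤ 1)
    (hT : p * ‖columnOperator a‖ ^ 2 ≤ ∫ w, feature σ a u w ^ 2 ∂(stdGaussian E)) :
    ∫ w, (feature σ a u w ^ 2) ^ 2 ∂(stdGaussian E) ≤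
      1348 * ((∫ w, feature σ a u w ^ 2 ∂(stdGaussian E)) / p) ^ 2 := by
  have h := integral_pow_four_stdGaussian_le (lipschitzWith_feature (a := a) hσ hu)
  set b := ∫ w, feature σ a u w ^ 2 ∂(stdGaussian E)
  have hb : 0 ≤ b := integral_nonneg fun w => sq_nonneg _
  calc ∫ w, (feature σ a u w ^ 2) ^ 2 ∂(stdGaussian E)
      = ∫ w, feature σ a u w ^ 4 ∂(stdGaussian E) := by simp only [← pow_mul]
    _ ≤ 1344 * (‖columnOperator a‖ ^ 2) ^ 2 + 4 * b ^ 2 := by simpa [← pow_mul] using h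
    _ ≤ 1344 * (b / p) ^ 2 + 4 * (b / p) ^ 2 := by
        gcongr
        · rwa [le_div_iff₀' hp0]
        · exact le_div_self hb hp0 hp1
    _ = 1348 * (b / p) ^ 2 := by ring

lemma memLp_feature_sq (hσ : LipschitzWith 1 σ) {u : EuclideanSpace ℝ ι} (hu : ‖u‖ ≤ 1) :
    MemLp (fun w => feature σ a u w ^ 2) 2 (stdGaussian E) := by
  have hf : MemLp (feature σ a u) (4 : ℕ) (stdGaussian E) :=
    memLp_of_lipschitzWith (lipschitzWith_feature hσ hu) (by simp)
  refine (memLp_two_iff_integrable_sq (hf.1.pow 2)).2 ?_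
  simpa only [Pi.pow_apply, ← pow_mul] using integrable_pow_of_memLp hf

end SecondMoment

end Feature

section Samples

variable {Ω : Type*} [MeasurableSpace Ω] {P : Measure Ω} [IsProbabilityMeasure P] {κ : Type*}
  [Fintype κ] {S : Type*} [MeasurableSpace S] {ν : Measure S} {g : κ → Ω → S}
  (hlaw : ∀ i, HasLaw (g i) ν P) (hind : iIndepFun g P) {f : S → ℝ} (hf : Measurable f)

include hlaw hind hf

lemma measureReal_sum_comp_le_le {b M s : ℝ} (hL2 : MemLp f 2 ν) (hf0 : ∀ x, 0 ≤ f x)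
    (hM : 0 < M) (hmean : b ≤ ∫ x, f x ∂ν) (hsq : ∫ x, f x ^ 2 ∂ν ≤ M) (hs : 0 ≤ s) :
    P.real {ω | ∑ i, f (g i ω) ≤ Fintype.card κ * (b - s)} ≤
      Real.exp (-(Fintype.card κ * (s ^ 2 / (2 * M)))) := by
  refine measureReal_sum_le_le_exp_of_nonneg (Y := fun i ω => f (g i ω))
    (hind.comp (fun _ => f) fun _ => hf) (fun i => ?_) (fun i ω => hf0 _) hM (fun i => ?_)
    (fun i => ?_) hs
  · exact ((hlaw i).map_eq ▸ hL2).comp_of_map (hlaw i).aemeasurable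
  · exact hmean.trans_eq ((hlaw i).integral_comp hf.aestronglyMeasurable).symm
  · exact ((hlaw i).integral_comp (hf.pow_const 2).aestronglyMeasurable).trans_le hsq

lemma measureReal_le_sum_comp_le {t A : ℝ} (ht : 0 ≤ t)
    (hint : Integrable (fun x => Real.exp (t * f x)) ν)
    (hmgf : ∫ x, Real.exp (t * f x) ∂ν ≤ Real.exp A) (c : ℝ) :
    P.real {ω | Fintype.card κ * c ≤ ∑ i, f (g i ω)} ≤
      Real.exp (Fintype.card κ * (A - t * c)) := by
  refine measureReal_le_sum_le_exp (Y := fun i ω => f (g i ω))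
    (hind.comp (fun _ => f) fun _ => hf) (fun i => hf.comp_aemeasurable (hlaw i).aemeasurable) ht
    (fun i => ?_) (fun i => ?_) c
  · exact ((hlaw i).map_eq ▸ hint).comp_aemeasurable (hlaw i).aemeasurable
  · exact ((hlaw i).integral_comp hint.aestronglyMeasurable).trans_le hmgf

end Samples

lemma one_sub_measureReal_le_of_compl_subset {Ω : Type*} [MeasurableSpace Ω] {P : Measure Ω}
    [IsProbabilityMeasure P] {s t : Set Ω} (h : sᶜ ⊆ t) : 1 - P.real t ≤ P.real s := by
  rw [sub_le_iff_le_add]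
  calc 1 = P.real (s ∪ t) := by rw [Set.compl_subset_iff_union.1 h, probReal_univ]
    _ ≤ P.real s + P.real t := measureReal_union_le s t

section Tails

variable {E : Type*} [NormedAddCommGroup E] [InnerProductSpace ℝ E] [FiniteDimensional ℝ E]
  [MeasurableSpace E] [BorelSpace E] {ι : Type*} [Fintype ι] {a : ι → E} {σ : ℝ → ℝ}
  {Ω : Type*} [MeasurableSpace Ω] {P : Measure Ω} [IsProbabilityMeasure P] {κ : Type*} [Fintype κ]
  {g : κ → Ω → E} {p ε : ℝ}
  (hlaw : ∀ i, HasLaw (g i) (stdGaussian E) P) (hind : iIndepFun g P)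
  (h0 : ∀ t, |σ t| ≤ |t|)

include hlaw hind h0

lemma measureReal_sum_rowSq_le_le (hσ : Measurable σ) (hF : 0 < ∑ j, ‖a j‖ ^ 2)
    (hp0 : 0 ≤ p) (hp : ∀ j, p * ‖a j‖ ^ 2 ≤ hermiteCoeff σ 1 ‖a j‖ ^ 2) (hε : 0 ≤ ε) :
    P.real {ω | ∑ i, rowSq σ a (g i ω) ≤ Fintype.card κ * ((1 - ε) * p * ∑ j, ‖a j‖ ^ 2)} ≤
      Real.exp (-(Fintype.card κ * ((ε * p) ^ 2 / 96))) := by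
  have hmean : p ≤ ∫ w, rowSq σ a w / ∑ j, ‖a j‖ ^ 2 ∂(stdGaussian E) := by
    rw [integral_div, le_div_iff₀ hF]
    exact mul_sum_sq_le_integral_rowSq h0 hσ hp
  have h := measureReal_sum_comp_le_le hlaw hind ((measurable_rowSq hσ).div_const _)
    (memLp_rowSq_div h0 hF hσ) (fun w => div_nonneg (rowSq_nonneg w) hF.le) (by norm_num) hmean
    (integral_sq_rowSq_div_le h0 hF) (mul_nonneg hε hp0)
  convert h using 4
  · rw [← Finset.sum_div, div_le_iff₀ hF]
    ring_nf
  · norm_num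

lemma measureReal_le_sum_rowSq_le (hσ : Measurable σ) (hF : 0 < ∑ j, ‖a j‖ ^ 2)
    (hε0 : 0 ≤ ε) (hε1 : ε ≤ 1) :
    P.real {ω | Fintype.card κ * ((1 + ε) * ∑ j, ‖a j‖ ^ 2) ≤ ∑ i, rowSq σ a (g i ω)} ≤
      Real.exp (-(Fintype.card κ * (ε ^ 2 / 8))) := by
  have h := measureReal_le_sum_comp_le hlaw hind ((measurable_rowSq hσ).div_const _)
    (by positivity : 0 ≤ ε / 4)
    (integrable_exp_mul_rowSq_div h0 hF hσ (by positivity) (by linarith))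
    (integral_exp_mul_rowSq_div_le h0 hF (by positivity) (by linarith)) (1 + ε)
  convert h using 4
  · rw [← Finset.sum_div, le_div_iff₀ hF, mul_assoc]
  · ring

omit h0 in
lemma measureReal_sum_feature_sq_lt_le (hσ : LipschitzWith 1 σ) {u : EuclideanSpace ℝ ι}
    (hu : ‖u‖ ≤ 1) (hp0 : 0 < p) (hp1 : p ≤ 1)
    (hT : p * ‖columnOperator a‖ ^ 2 ≤ ∫ w, feature σ a u w ^ 2 ∂(stdGaussian E))
    (hε0 : 0 ≤ ε) (hε1 : ε ≤ 1) :
    P.real {ω | ∑ i, feature σ a u (g i ω) ^ 2 <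
        Fintype.card κ * ((1 - ε) * p * ‖columnOperator a‖ ^ 2)} ≤
      Real.exp (-(Fintype.card κ * ((ε * p) ^ 2 / 2696))) := by
  set b := ∫ w, feature σ a u w ^ 2 ∂(stdGaussian E) with hb
  have hmono : Fintype.card κ * ((1 - ε) * p * ‖columnOperator a‖ ^ 2) ≤
      Fintype.card κ * (b - ε * b) := by
    rw [mul_assoc (1 - ε), ← one_sub_mul]
    gcongr
  rcases (hb ▸ integral_nonneg fun w => sq_nonneg _ : 0 ≤ b).eq_or_lt with hb0 | hb0
  · rw [← hb0, mul_zero, sub_zero, mul_zero] at hmono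
    have hempty : {ω | ∑ i, feature σ a u (g i ω) ^ 2 <
        Fintype.card κ * ((1 - ε) * p * ‖columnOperator a‖ ^ 2)} = ∅ :=
      Set.eq_empty_of_forall_notMem fun ω hω =>
        (Finset.sum_nonneg fun _ _ => sq_nonneg _).not_gt (hω.trans_le hmono)
    rw [hempty, measureReal_empty]
    positivity
  have h := measureReal_sum_comp_le_le hlaw hind (f := fun w => feature σ a u w ^ 2)
    ((lipschitzWith_feature hσ hu).continuous.measurable.pow_const 2) (memLp_feature_sq hσ hu)
    (fun w => sq_nonneg _) (M := 1348 * (b / p) ^ 2) (by positivity) hb.le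
    (integral_sq_feature_sq_le hσ hu hp0 hp1 hT) (s := ε * b) (by positivity)
  refine (measureReal_mono fun ω hω => hω.le.trans hmono).trans (h.trans_eq ?_)
  congr 3
  field_simp
  ring

lemma exists_one_sub_exp_le_measureReal (hσ : LipschitzWith 1 σ) (hF : 0 < ∑ j, ‖a j‖ ^ 2)
    (hp0 : 0 < p) (hp1 : p ≤ 1) (hp : ∀ j, p * ‖a j‖ ^ 2 ≤ hermiteCoeff σ 1 ‖a j‖ ^ 2)
    (hε0 : 0 ≤ ε) (hε1 : ε ≤ 1) :
    ∃ u : EuclideanSpace ℝ ι, ‖u‖ ≤ 1 ∧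
      1 - 3 * Real.exp (-(Fintype.card κ * ((ε * p) ^ 2 / 2696))) ≤
      P.real {ω |
        Fintype.card κ * ((1 - ε) * p * ∑ j, ‖a j‖ ^ 2) ≤ ∑ i, rowSq σ a (g i ω) ∧
        ∑ i, rowSq σ a (g i ω) ≤ Fintype.card κ * ((1 + ε) * ∑ j, ‖a j‖ ^ 2) ∧
        Fintype.card κ * ((1 - ε) * p * ‖columnOperator a‖ ^ 2) ≤
          ∑ i, feature σ a u (g i ω) ^ 2} := by
  have hσm := hσ.continuous.measurable
  obtain ⟨u, hu, hT⟩ :=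
    exists_mul_sq_norm_columnOperator_le_integral_feature_sq hσ h0 hp0 hp
  refine ⟨u, hu, ?_⟩
  have frob_lower := measureReal_sum_rowSq_le_le hlaw hind h0 hσm hF hp0.le hp hε0
  have frob_upper := measureReal_le_sum_rowSq_le hlaw hind h0 hσm hF hε0 hε1
  have op_lower := measureReal_sum_feature_sq_lt_le hlaw hind hσ hu hp0 hp1 hT hε0 hε1
  have rate_lower : Real.exp (-(Fintype.card κ * ((ε * p) ^ 2 / 96))) ≤
      Real.exp (-(Fintype.card κ * ((ε * p) ^ 2 / 2696))) := by
    gcongr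
    norm_num
  have rate_upper : Real.exp (-(Fintype.card κ * (ε ^ 2 / 8))) ≤
      Real.exp (-(Fintype.card κ * ((ε * p) ^ 2 / 2696))) := by
    gcongr
    · exact mul_le_of_le_one_right hε0 hp1
    · norm_num
  set frobLow := {ω | ∑ i, rowSq σ a (g i ω) ≤ Fintype.card κ * ((1 - ε) * p * ∑ j, ‖a j‖ ^ 2)}
  set frobHigh := {ω | Fintype.card κ * ((1 + ε) * ∑ j, ‖a j‖ ^ 2) ≤ ∑ i, rowSq σ a (g i ω)}
  set opLow := {ω | ∑ i, feature σ a u (g i ω) ^ 2 <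
    Fintype.card κ * ((1 - ε) * p * ‖columnOperator a‖ ^ 2)}
  refine le_trans ?_ (one_sub_measureReal_le_of_compl_subset (t := frobLow ∪ frobHigh ∪ opLow)
    fun ω hω => ?_)
  · linarith [measureReal_union_le (μ := P) (frobLow ∪ frobHigh) opLow,
      measureReal_union_le (μ := P) frobLow frobHigh]
  · contrapose! hω
    simp only [frobLow, frobHigh, opLow, Set.mem_union, Set.mem_ofPred_eq, not_or, not_le,
      not_lt] at hω
    exact Set.notMem_compl_iff.2 ⟨hω.1.1.le, hω.1.2.le, hω.2⟩

end Tails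

section Norms

variable {m n : ℕ}

lemma frobNorm_sq (A : Matrix (Fin m) (Fin n) ℝ) : frobNorm A ^ 2 = ∑ i, ∑ j, A i j ^ 2 := by
  rw [frobNorm, Matrix.frobenius_norm_def, ← Real.sqrt_eq_rpow, Real.sq_sqrt (by positivity)]
  simp only [Real.norm_eq_abs, Real.rpow_two, sq_abs]

open scoped Matrix.Norms.L2Operator in
lemma opNorm_pos {A : Matrix (Fin m) (Fin n) ℝ} (hA : A ≠ 0) : 0 < opNorm A :=
  norm_pos_iff.2 hA

open scoped Matrix.Norms.L2Operator in
lemma sum_sq_mulVec_le_opNorm_sq (A : Matrix (Fin m) (Fin n) ℝ) {u : EuclideanSpace ℝ (Fin n)}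
    (hu : ‖u‖ ≤ 1) : ∑ i, A.mulVec u i ^ 2 ≤ opNorm A ^ 2 := by
  calc ∑ i, A.mulVec u i ^ 2 = ‖WithLp.toLp 2 (A.mulVec u)‖ ^ 2 := by
        rw [EuclideanSpace.real_norm_sq_eq]
    _ ≤ (‖A‖ * 1) ^ 2 := by
        gcongr
        exact (A.l2_opNorm_mulVec u).trans (by gcongr)
    _ = opNorm A ^ 2 := by rw [mul_one, opNorm]

end Norms

section Rescaling

variable {k d n : ℕ} {X : Matrix (Fin d) (Fin n) ℝ} {σ : ℝ → ℝ}

/-- The `j`-th column of `X` divided by `√d`. Moving the factor `1/√d` from `W` to `X` turns the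
rows of `W` into standard Gaussian vectors. -/
noncomputable def scaledCol (X : Matrix (Fin d) (Fin n) ℝ) (j : Fin n) :
    EuclideanSpace ℝ (Fin d) := (√d)⁻¹ • WithLp.toLp 2 (X.col j)

/-- The `i`-th row of `W` multiplied by `√d`, to be paired with `scaledCol`. -/
noncomputable def scaledRow (W : Matrix (Fin k) (Fin d) ℝ) (i : Fin k) :
    EuclideanSpace ℝ (Fin d) := WithLp.toLp 2 fun j => √d * W i j

lemma norm_scaledCol (X : Matrix (Fin d) (Fin n) ℝ) (j : Fin n) :
    ‖scaledCol X j‖ = colNorm X j / √d := by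
  rw [scaledCol, norm_smul, norm_inv, Real.norm_of_nonneg (Real.sqrt_nonneg _), colNorm,
    inv_mul_eq_div]

lemma sum_norm_scaledCol_sq (X : Matrix (Fin d) (Fin n) ℝ) :
    ∑ j, ‖scaledCol X j‖ ^ 2 = frobNorm X ^ 2 / d := by
  simp only [norm_scaledCol, div_pow, Real.sq_sqrt (Nat.cast_nonneg d), colNorm,
    EuclideanSpace.real_norm_sq_eq, ← Finset.sum_div, Matrix.col_apply, frobNorm_sq]
  rw [Finset.sum_comm]

lemma columnOperator_scaledCol_apply (X : Matrix (Fin d) (Fin n) ℝ)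
    (y : EuclideanSpace ℝ (Fin n)) :
    columnOperator (scaledCol X) y = (√d)⁻¹ • WithLp.toLp 2 (X.mulVec y) := by
  ext i
  simp only [columnOperator_apply, scaledCol, WithLp.ofLp_sum, WithLp.ofLp_smul, Finset.sum_apply,
    Pi.smul_apply, smul_eq_mul, Matrix.col_apply, Matrix.mulVec, dotProduct, Finset.mul_sum]
  exact Finset.sum_congr rfl fun j _ => by ring

open scoped Matrix.Norms.L2Operator in
lemma norm_columnOperator_scaledCol (X : Matrix (Fin d) (Fin n) ℝ) :
    ‖columnOperator (scaledCol X)‖ = opNorm X / √d := by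
  have h : columnOperator (scaledCol X) = (√d)⁻¹ •
      (Matrix.toEuclideanLin (𝕜 := ℝ)).trans LinearMap.toContinuousLinearMap X := by
    ext1 y
    exact columnOperator_scaledCol_apply X y
  rw [h, norm_smul, norm_inv, Real.norm_of_nonneg (Real.sqrt_nonneg _), opNorm,
    Matrix.l2_opNorm_def, inv_mul_eq_div]

lemma inner_scaledCol_scaledRow (hd : d ≠ 0) (W : Matrix (Fin k) (Fin d) ℝ) (i : Fin k)
    (j : Fin n) : ⟪scaledCol X j, scaledRow W i⟫ = (W * X) i j := by
  simp only [scaledCol, scaledRow, Matrix.mul_apply, PiLp.inner_apply, RCLike.inner_apply,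
    conj_trivial, PiLp.smul_apply, smul_eq_mul, Matrix.col_apply]
  exact Finset.sum_congr rfl fun l _ => by field_simp

lemma sum_rowSq_scaledRow (hd : d ≠ 0) (W : Matrix (Fin k) (Fin d) ℝ) :
    ∑ i, rowSq σ (scaledCol X) (scaledRow W i) = frobNorm ((W * X).map σ) ^ 2 := by
  simp only [rowSq, inner_scaledCol_scaledRow hd, frobNorm_sq, Matrix.map_apply]

lemma sum_feature_scaledRow_sq_le (hd : d ≠ 0) (W : Matrix (Fin k) (Fin d) ℝ)
    {u : EuclideanSpace ℝ (Fin n)} (hu : ‖u‖ ≤ 1) :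
    ∑ i, feature σ (scaledCol X) u (scaledRow W i) ^ 2 ≤ opNorm ((W * X).map σ) ^ 2 := by
  convert sum_sq_mulVec_le_opNorm_sq ((W * X).map σ) hu using 3 with i
  simp only [feature, inner_scaledCol_scaledRow hd, Matrix.mulVec, dotProduct, Matrix.map_apply,
    mul_comm]

lemma columnParam_eq_div (σ : ℝ → ℝ) (X : Matrix (Fin d) (Fin n) ℝ) (j : Fin n) :
    columnParam σ X j = hermiteCoeff σ 1 ‖scaledCol X j‖ ^ 2 / ‖scaledCol X j‖ ^ 2 := by
  rw [columnParam, norm_scaledCol, div_pow (colNorm X j), Real.sq_sqrt (Nat.cast_nonneg d),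
    div_div_eq_mul_div, div_mul_eq_mul_div, mul_comm]

lemma mul_sq_norm_scaledCol_le {p : ℝ} {j : Fin n} (hp : p ≤ columnParam σ X j) :
    p * ‖scaledCol X j‖ ^ 2 ≤ hermiteCoeff σ 1 ‖scaledCol X j‖ ^ 2 :=
  mul_le_of_le_div₀ (sq_nonneg _) (sq_nonneg _) (columnParam_eq_div σ X j ▸ hp)

lemma scaledCol_ne_zero_of_columnParam_pos {j : Fin n} (h : 0 < columnParam σ X j) :
    scaledCol X j ≠ 0 := by
  intro hX
  simp [columnParam_eq_div, hX] at h

lemma ne_zero_of_columnParam_pos {j : Fin n} (h : 0 < columnParam σ X j) : X ≠ 0 := by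
  rintro rfl
  exact scaledCol_ne_zero_of_columnParam_pos h (smul_zero _)

end Rescaling

section GaussianMatrix

variable {Ω : Type*} [MeasurableSpace Ω] {P : Measure Ω} {k d : ℕ}
  {W : Ω → Matrix (Fin k) (Fin d) ℝ}

lemma IsGaussianMatrix.hasLaw_scaledRow (hW : IsGaussianMatrix P W) (hd : d ≠ 0) (i : Fin k) :
    HasLaw (fun ω => scaledRow (W ω) i) (stdGaussian (EuclideanSpace ℝ (Fin d))) P := by
  have hentry (j : Fin d) : HasLaw (fun ω => √d * W ω i j) (gaussianReal 0 1) P := by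
    convert gaussianReal_const_mul (hW.law i j) √d
    · simp
    · ext
      simp [hd]
  have hind : iIndepFun (fun j ω => √d * W ω i j) P :=
    (hW.indep.precomp (g := fun j => (i, j)) (Prod.mk_right_injective i)).comp
      (fun _ x => √d * x) fun _ => measurable_const_mul _
  have htoLp : HasLaw (WithLp.toLp 2) (stdGaussian (EuclideanSpace ℝ (Fin d)))
      (Measure.pi fun _ : Fin d => gaussianReal 0 1) :=
    ⟨by fun_prop, map_pi_eq_stdGaussian⟩
  exact htoLp.comp (hind.hasLaw_pi hentry)

lemma IsGaussianMatrix.iIndepFun_row (hW : IsGaussianMatrix P W) :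
    iIndepFun (fun i ω => W ω i) P := by
  have := hW.indep.isProbabilityMeasure
  have hjoint : HasGaussianLaw (fun ω (ij : Fin k × Fin d) => W ω ij.1 ij.2) P :=
    hW.indep.hasGaussianLaw fun ij => (hW.law ij.1 ij.2).hasGaussianLaw
  have hrows : HasGaussianLaw (fun ω (i : Fin k) (j : Fin d) => W ω i j) P :=
    hjoint.map_fun (ContinuousLinearMap.pi fun i => ContinuousLinearMap.pi fun j =>
      ContinuousLinearMap.proj (R := ℝ) (φ := fun _ : Fin k × Fin d => ℝ) (i, j))
  refine hrows.iIndepFun_of_covariance_eval (X := fun i j ω => W ω i j) fun i i' hne j j' => ?_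
  exact (hW.indep.indepFun (i := (i, j)) (j := (i', j')) (by simp [hne])).covariance_eq_zero
    (hW.law i j).hasGaussianLaw.memLp_two (hW.law i' j').hasGaussianLaw.memLp_two

lemma IsGaussianMatrix.iIndepFun_scaledRow (hW : IsGaussianMatrix P W) :
    iIndepFun (fun i ω => scaledRow (W ω) i) P :=
  hW.iIndepFun_row.comp (fun _ w => WithLp.toLp 2 fun j => √d * w j) fun _ => by fun_prop

end GaussianMatrix

section NormBounds

variable {k d n : ℕ} {X : Matrix (Fin d) (Fin n) ℝ} {σ : ℝ → ℝ} {p ε : ℝ}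

lemma NormBounds.stableRank_map_le {W : Matrix (Fin k) (Fin d) ℝ} (h : NormBounds σ p ε W X)
    (hX : X ≠ 0) (hp : 0 < p) (hε : ε < 1) :
    stableRank ((W * X).map σ) ≤ (1 + ε) / (1 - ε) * (1 / p) * stableRank X := by
  obtain ⟨-, frob_upper, op_lower⟩ := h
  have hd : d ≠ 0 := by
    rintro rfl
    exact hX (Subsingleton.elim _ _)
  have hO : 0 < opNorm X := opNorm_pos hX
  have hε' : 0 < 1 - ε := sub_pos.2 hε
  have op_pos : 0 < (1 - ε) * (p / d) * opNorm X ^ 2 := by positivity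
  have hk : (1 / k : ℝ) ≠ 0 := fun hk => by
    rw [hk, zero_mul] at op_lower
    exact op_lower.not_gt op_pos
  calc stableRank ((W * X).map σ)
      = 1 / k * frobNorm ((W * X).map σ) ^ 2 / (1 / k * opNorm ((W * X).map σ) ^ 2) :=
        (mul_div_mul_left _ _ hk).symm
    _ ≤ (1 + ε) * (1 / d) * frobNorm X ^ 2 / ((1 - ε) * (p / d) * opNorm X ^ 2) :=
        div_le_div₀ (le_trans (by positivity) frob_upper) frob_upper op_pos op_lower
    _ = (1 + ε) / (1 - ε) * (1 / p) * stableRank X := by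
        rw [stableRank]
        field_simp

lemma normBounds_of_sum_rowSq_of_sum_feature_sq (hk : k ≠ 0) (hd : d ≠ 0)
    {W : Matrix (Fin k) (Fin d) ℝ} {u : EuclideanSpace ℝ (Fin n)} (hu : ‖u‖ ≤ 1)
    (frob_lower : k * ((1 - ε) * p * ∑ j, ‖scaledCol X j‖ ^ 2) ≤
      ∑ i, rowSq σ (scaledCol X) (scaledRow W i))
    (frob_upper : ∑ i, rowSq σ (scaledCol X) (scaledRow W i) ≤
      k * ((1 + ε) * ∑ j, ‖scaledCol X j‖ ^ 2))
    (op_lower : k * ((1 - ε) * p * ‖columnOperator (scaledCol X)‖ ^ 2) ≤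
      ∑ i, feature σ (scaledCol X) u (scaledRow W i) ^ 2) :
    NormBounds σ p ε W X := by
  rw [sum_rowSq_scaledRow hd, sum_norm_scaledCol_sq] at frob_lower frob_upper
  rw [norm_columnOperator_scaledCol, div_pow, Real.sq_sqrt (Nat.cast_nonneg d)] at op_lower
  have hk' : (0 : ℝ) < k := by positivity
  refine ⟨?_, ?_, ?_⟩
  · rw [one_div_mul_eq_div, le_div_iff₀' hk']
    exact frob_lower.trans_eq' (by ring)
  · rw [one_div_mul_eq_div, div_le_iff₀' hk']
    exact frob_upper.trans_eq (by ring)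
  · rw [one_div_mul_eq_div, le_div_iff₀' hk']
    exact (op_lower.trans (sum_feature_scaledRow_sq_le hd W hu)).trans_eq' (by ring)

lemma IsGaussianMatrix.one_sub_exp_le_measureReal_normBounds [NeZero n]
    {Ω : Type*} [MeasurableSpace Ω] {P : Measure Ω} [IsProbabilityMeasure P]
    {W : Ω → Matrix (Fin k) (Fin d) ℝ} (hW : IsGaussianMatrix P W) (hσ : LipschitzWith 1 σ)
    (h0 : ∀ t, |σ t| ≤ |t|) (hp0 : 0 < p) (hp : ∀ j, p ≤ columnParam σ X j) (hε0 : 0 ≤ ε)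
    (hε1 : ε ≤ 1) :
    1 - 3 * Real.exp (-(k * ((ε * p) ^ 2 / 2696))) ≤ P.real {ω | NormBounds σ p ε (W ω) X} := by
  have hcol (j : Fin n) : scaledCol X j ≠ 0 :=
    scaledCol_ne_zero_of_columnParam_pos (hp0.trans_le (hp j))
  have hd : d ≠ 0 := by
    rintro rfl
    exact hcol 0 (Subsingleton.elim _ _)
  rcases eq_or_ne k 0 with rfl | hk
  · refine le_trans ?_ measureReal_nonneg
    norm_num
  have hp1 : p ≤ 1 := le_one_of_mul_sq_le_sq_hermiteCoeff hσ.continuous.measurable h0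
    (norm_ne_zero_iff.2 (hcol 0)) (mul_sq_norm_scaledCol_le (hp 0))
  have hF : 0 < ∑ j, ‖scaledCol X j‖ ^ 2 :=
    Finset.sum_pos (fun j _ => pow_pos (norm_pos_iff.2 (hcol j)) 2) Finset.univ_nonempty
  obtain ⟨u, hu, hgood⟩ := exists_one_sub_exp_le_measureReal (hW.hasLaw_scaledRow hd)
    hW.iIndepFun_scaledRow h0 hσ hF hp0 hp1 (fun j => mul_sq_norm_scaledCol_le (hp j)) hε0 hε1
  rw [Fintype.card_fin] at hgood
  exact hgood.trans (measureReal_mono fun ω ⟨frob_lower, frob_upper, op_lower⟩ =>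
    normBounds_of_sum_rowSq_of_sum_feature_sq hk hd hu frob_lower frob_upper op_lower)

end NormBounds

end StableRank

theorem mainTheorem9 :
    ∃ c : ℝ, 0 < c ∧
      ∀ {Ω : Type*} [MeasurableSpace Ω] (P : Measure Ω) [IsProbabilityMeasure P]
        (k d n : ℕ) (W : Ω → Matrix (Fin k) (Fin d) ℝ)
        (_ : StableRank.IsGaussianMatrix P W)
        (X : Matrix (Fin d) (Fin n) ℝ) (σ : ℝ → ℝ)
        (_ : LipschitzWith 1 σ) (_ : ∀ t, |σ t| ≤ |t|)
        (p : ℝ) (_ : IsLeast (Set.range (StableRank.columnParam σ X)) p) (_ : 0 < p)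
        (ε : ℝ) (_ : 0 < ε) (_ : ε < 1),
        1 - 8 * Real.exp (-c * ε ^ 2 * p ^ 2 * k) ≤
          P.real {ω | StableRank.NormBounds σ p ε (W ω) X} ∧
        ∀ ω, StableRank.NormBounds σ p ε (W ω) X →
          StableRank.stableRank ((W ω * X).map σ) ≤
            (1 + ε) / (1 - ε) * (1 / p) * StableRank.stableRank X := by
  refine ⟨1 / 2696, by norm_num, ?_⟩
  intro Ω _ P _ k d n W hW X σ hσ h0 p hp hp0 ε hε0 hε1
  have hple (j : Fin n) : p ≤ StableRank.columnParam σ X j := hp.2 (Set.mem_range_self j)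
  obtain ⟨j₀, -⟩ := hp.1
  have : NeZero n := ⟨j₀.pos.ne'⟩
  have hX : X ≠ 0 := StableRank.ne_zero_of_columnParam_pos (hp0.trans_le (hple j₀))
  refine ⟨?_, fun ω hω => hω.stableRank_map_le hX hp0 hε1⟩
  calc 1 - 8 * Real.exp (-(1 / 2696) * ε ^ 2 * p ^ 2 * k)
      ≤ 1 - 3 * Real.exp (-(k * ((ε * p) ^ 2 / 2696))) := by
        rw [show -(1 / 2696) * ε ^ 2 * p ^ 2 * k = -(k * ((ε * p) ^ 2 / 2696)) by ring]
        gcongr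
        norm_num
    _ ≤ P.real {ω | StableRank.NormBounds σ p ε (W ω) X} :=
        hW.one_sub_exp_le_measureReal_normBounds hσ h0 hp0 hple hε0.le hε1.le
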